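/- For $n\ge 1$ let $\mathfrak S_n$ be the symmetric group on $\{1,\dots,n\}$, with $(uv)(i)=u(v(i))$, and let $s_i=(i,\,i+1)$ for $1\le i\le n-1$. A reduced decomposition of $w\in\mathfrak S_n$ is an expression $w=s_{i_1}\cdots s_{i_\ell}$ with $\ell$ minimal; the support $\mathrm{supp}(w)$ is the set of those $s_i$ that appear in a reduced decomposition of $w$ (it does not depend on the choice of the decomposition). The Bruhat order on $\mathfrak S_n$ is given by $v\le w$ if and only if a reduced decomposition of $v$ is a (not necessarily contiguous) subword of some reduced decomposition of $w$. For $v\le w$ the Bruhat interval polytope is $$Q_{v,w}=\mathrm{Conv}\{(u(1),\dots,u(n))\in\mathbb R^n \mid v\le u\le w\}.$$ Two convex polytopes are combinatorially equivalent if their posets of faces, ordered by inclusion, are isomorphic. Let $I=[0,1]$. Proposition. Let $v,w\in\mathfrak S_n$ with $v\le w$, let $1\le r\le n-1$, and suppose that $s_r\notin\mathrm{supp}(w)$. Then both $Q_{v,s_rw}$ and $Q_{v,ws_r}$ are combinatorially equivalent to $Q_{v,w}\times I$. -/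

import Mathlib

namespace BruhatPolytope

/-- The simple transposition exchanging the consecutive elements `r` and `r + 1`.  The set
`{1, …, n}` is modelled by `Fin n`, so the simple transpositions are indexed by `Fin (n - 1)`. -/
def simpleSwap {n : ℕ} (r : Fin (n - 1)) : Equiv.Perm (Fin n) :=
  Equiv.swap ⟨r.val, by omega⟩ ⟨r.val + 1, by omega⟩

/-- The product of simple transpositions spelled by a word in their indices. -/
def wordProd {n : ℕ} (ω : List (Fin (n - 1))) : Equiv.Perm (Fin n) :=
  (ω.map simpleSwap).prod

/-- `ω` is a reduced decomposition of `w`: it spells `w`, and no shorter word does. -/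
def IsReducedWord {n : ℕ} (ω : List (Fin (n - 1))) (w : Equiv.Perm (Fin n)) : Prop :=
  wordProd ω = w ∧ ∀ ω' : List (Fin (n - 1)), wordProd ω' = w → ω.length ≤ ω'.length

/-- The support of `w`: the letters that appear in a reduced decomposition of `w`. -/
def support {n : ℕ} (w : Equiv.Perm (Fin n)) : Set (Fin (n - 1)) :=
  {r | ∃ ω, IsReducedWord ω w ∧ r ∈ ω}

/-- The Bruhat order: some reduced decomposition of `v` is a (not necessarily contiguous) subword
of some reduced decomposition of `w`. -/
def BruhatLE {n : ℕ} (v w : Equiv.Perm (Fin n)) : Prop :=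
  ∃ α β : List (Fin (n - 1)), IsReducedWord α v ∧ IsReducedWord β w ∧ α.Sublist β

/-- The Bruhat interval `[v, w]`. -/
def bruhatInterval {n : ℕ} (v w : Equiv.Perm (Fin n)) : Set (Equiv.Perm (Fin n)) :=
  {u | BruhatLE v u ∧ BruhatLE u w}

/-- The point `(u(1), …, u(n))` of `ℝⁿ`; the shift by one turns the values `0, …, n - 1` of
elements of `Fin n` into `1, …, n`. -/
def permPoint {n : ℕ} (u : Equiv.Perm (Fin n)) : Fin n → ℝ :=
  fun i => ((u i).val : ℝ) + 1

/-- The Bruhat interval polytope `Q_{v,w}`. -/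
def bruhatIntervalPolytope {n : ℕ} (v w : Equiv.Perm (Fin n)) : Set (Fin n → ℝ) :=
  convexHull ℝ (permPoint '' bruhatInterval v w)

/-- The faces of a polytope `P`, ordered by inclusion: the empty face, and the sets of maximizers
on `P` of a linear functional (`P` itself for the zero functional). -/
abbrev Face {E : Type*} [AddCommGroup E] [Module ℝ E] [TopologicalSpace E] (P : Set E) : Type _ :=
  {F : Set E // IsExposed ℝ P F}

/-- Two polytopes are combinatorially equivalent if their face lattices are isomorphic. -/
def CombinatoriallyEquivalent {E E' : Type*}
    [AddCommGroup E] [Module ℝ E] [TopologicalSpace E]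
    [AddCommGroup E'] [Module ℝ E'] [TopologicalSpace E']
    (P : Set E) (P' : Set E') : Prop :=
  Nonempty (Face P ≃o Face P')

end BruhatPolytope

namespace BruhatPolytope

/-! ### Simple transpositions and ascents. -/

open Equiv Finset

variable {n : ℕ}

/-! Since `r` is outside the support, `w` preserves the set of the first `r + 1` positions, and so
does every element below `w`, because this is the vanishing of one rank. Every element of `[v, w]`
then takes `lo r` before `hi r`, and the lifting property splits the longer interval into `[v, w]`
and its translate by the transposition, on the left or on the right. The larger polytope is the hull
of two copies `a`, `b` of one family of points, with labels in `[v, w] × Bool`. It suffices that its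
nonempty faces have as label sets exactly the products of a face of `a` with a nonempty set of
Booleans, since the prism has the same label sets.

On the right, `b` is the image of `a` under an exchange of two coordinates, and each point moves by
a positive multiple of one vector `e`. The sign of a functional on `e` decides which copy carries
the maximum. It can be prescribed freely by adding a multiple of the sum of the first `r + 1`
coordinates, which is constant on `a`.

On the left the points move in different directions, but the copies lie in parallel hyperplanes, and
it is enough that every functional has the same maximizers on both. A functional with coefficients
`c` takes at `u` a constant minus the sum of the prefix sums of `c` along `u⁻¹`; the transposition
changes it by a constant minus two of these prefix sums. The maximizers therefore agree as soon as
some element of `[v⁻¹, w⁻¹]` minimizes all prefix sums at once: Bruhat intervals are flag matroids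
(`exists_forall_prefixSum_le`).

For this the interval is represented by a real matrix whose nonzero minors in the first `k` columns
sit exactly at the initial segments of its elements. Greedy bases are optimal and nested, so they
assemble to the required permutation. The matrix is built by induction on the inversions of `w`:
either two rows are exchanged (`Represents.translate`), or a generic multiple of one row is added to
the next (`Represents.exists_bridge`). The second step rests on `exists_pre_eq_or`, whose hard case
is the extremal argument `exists_extremal`. The Bruhat order is handled throughout as the rank order
(`bruhatLE_iff_rankLE`), where lifting is arithmetic in three consecutive rows. -/

/-- The smaller of the two values exchanged by `simpleSwap i`. -/
def lo (i : Fin (n - 1)) : Fin n := ⟨i.val, by omega⟩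

/-- The larger of the two values exchanged by `simpleSwap i`. -/
def hi (i : Fin (n - 1)) : Fin n := ⟨i.val + 1, by omega⟩

@[simp] lemma lo_val (i : Fin (n - 1)) : (lo i).val = i.val := rfl
@[simp] lemma hi_val (i : Fin (n - 1)) : (hi i).val = i.val + 1 := rfl

lemma lo_ne_hi (i : Fin (n - 1)) : lo i ≠ hi i := by
  intro h; have := congrArg Fin.val h; simp at this

@[simp] lemma simpleSwap_lo (i : Fin (n - 1)) : simpleSwap i (lo i) = hi i := swap_apply_left _ _
@[simp] lemma simpleSwap_hi (i : Fin (n - 1)) : simpleSwap i (hi i) = lo i := swap_apply_right _ _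

@[simp] lemma simpleSwap_inv (i : Fin (n - 1)) : (simpleSwap i)⁻¹ = simpleSwap i := swap_inv _ _

@[simp] lemma simpleSwap_mul_self (i : Fin (n - 1)) : simpleSwap i * simpleSwap i = 1 :=
  swap_mul_self _ _

@[simp] lemma simpleSwap_mul_cancel (i : Fin (n - 1)) (u : Perm (Fin n)) :
    simpleSwap i * (simpleSwap i * u) = u := by
  rw [← mul_assoc, simpleSwap_mul_self, one_mul]

lemma simpleSwap_apply (i : Fin (n - 1)) (x : Fin n) :
    simpleSwap i x = if x = lo i then hi i else if x = hi i then lo i else x :=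
  swap_apply_def _ _ _

@[simp] lemma simpleSwap_mul_inv_lo (i : Fin (n - 1)) (u : Perm (Fin n)) :
    (simpleSwap i * u)⁻¹ (lo i) = u⁻¹ (hi i) := by
  rw [mul_inv_rev, simpleSwap_inv, Perm.mul_apply, simpleSwap_lo]

@[simp] lemma simpleSwap_mul_inv_hi (i : Fin (n - 1)) (u : Perm (Fin n)) :
    (simpleSwap i * u)⁻¹ (hi i) = u⁻¹ (lo i) := by
  rw [mul_inv_rev, simpleSwap_inv, Perm.mul_apply, simpleSwap_hi]

lemma le_simpleSwap_val (i : Fin (n - 1)) (x : Fin n) {b : ℕ} (hb : b ≠ i.val + 1) :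
    b ≤ (simpleSwap i x).val ↔ b ≤ x.val := by
  rw [simpleSwap_apply]
  split_ifs with h1 h2
  · subst h1; simp; omega
  · subst h2; simp; omega
  · rfl

/-- `Ascends i u`: the value `i` is taken to the left of the value `i + 1`. -/
def Ascends (i : Fin (n - 1)) (u : Perm (Fin n)) : Prop := u⁻¹ (lo i) < u⁻¹ (hi i)

lemma ascends_or (i : Fin (n - 1)) (u : Perm (Fin n)) :
    Ascends i u ∨ Ascends i (simpleSwap i * u) := by
  unfold Ascends
  rw [simpleSwap_mul_inv_lo, simpleSwap_mul_inv_hi]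
  exact lt_or_gt_of_ne fun h => lo_ne_hi i (u⁻¹.injective h)

lemma not_ascends_iff (i : Fin (n - 1)) (u : Perm (Fin n)) :
    ¬ Ascends i u ↔ Ascends i (simpleSwap i * u) := by
  refine ⟨(ascends_or i u).resolve_left, fun h h' => ?_⟩
  unfold Ascends at h h'
  rw [simpleSwap_mul_inv_lo, simpleSwap_mul_inv_hi] at h
  exact lt_asymm h h'

/-! ### The rank function of a permutation -/

/-- The number of positions left of `a` that carry a value at least `b`. -/
def rk (u : Perm (Fin n)) (a b : ℕ) : ℕ := #{j : Fin n | j.val < a ∧ b ≤ (u j).val}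

/-- The indicator of the value `x` being taken left of `a`. -/
def occ (u : Perm (Fin n)) (x : Fin n) (a : ℕ) : ℕ := if (u⁻¹ x).val < a then 1 else 0

/-- The rank order on permutations. -/
def RankLE (v w : Perm (Fin n)) : Prop := ∀ a b, rk v a b ≤ rk w a b

lemma RankLE.refl (v : Perm (Fin n)) : RankLE v v := fun _ _ => le_rfl

lemma RankLE.trans {u v w : Perm (Fin n)} (h : RankLE u v) (h' : RankLE v w) : RankLE u w :=
  fun a b => (h a b).trans (h' a b)

lemma rk_eq_sum (u : Perm (Fin n)) (a b : ℕ) :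
    rk u a b = ∑ j : Fin n, if j.val < a ∧ b ≤ (u j).val then 1 else 0 := by
  rw [rk, Finset.card_filter]

lemma occ_eq_sum (u : Perm (Fin n)) (x : Fin n) (a : ℕ) :
    occ u x a = ∑ j : Fin n, if j.val < a ∧ u j = x then 1 else 0 := by
  rw [Finset.sum_eq_single (u⁻¹ x)]
  · simp [occ]
  · intro j _ hj
    rw [if_neg]
    rintro ⟨-, h⟩
    exact hj (by rw [← h]; simp)
  · simp

lemma rk_succ (u : Perm (Fin n)) (a : ℕ) (x : Fin n) :
    rk u a x.val = rk u a (x.val + 1) + occ u x a := by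
  rw [rk_eq_sum, rk_eq_sum, occ_eq_sum, ← Finset.sum_add_distrib]
  refine Finset.sum_congr rfl fun j _ => ?_
  have : u j = x ↔ (u j).val = x.val := Fin.ext_iff
  simp only [this]
  split_ifs <;> omega

lemma occ_le_one (u : Perm (Fin n)) (x : Fin n) (a : ℕ) : occ u x a ≤ 1 := by
  unfold occ; split_ifs <;> omega

lemma rk_lo (u : Perm (Fin n)) (i : Fin (n - 1)) (a : ℕ) :
    rk u a i.val = rk u a (i.val + 1) + occ u (lo i) a := rk_succ u a (lo i)

lemma rk_hi (u : Perm (Fin n)) (i : Fin (n - 1)) (a : ℕ) :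
    rk u a (i.val + 1) = rk u a (i.val + 2) + occ u (hi i) a := rk_succ u a (hi i)

/-- Only the threshold `i + 1` separates the two exchanged values, so every comparison below reduces
to that row. -/
lemma rk_simpleSwap_mul_of_ne (i : Fin (n - 1)) (u : Perm (Fin n)) (a : ℕ) {b : ℕ}
    (hb : b ≠ i.val + 1) : rk (simpleSwap i * u) a b = rk u a b := by
  unfold rk
  simp only [Perm.mul_apply, le_simpleSwap_val i _ hb]

lemma rk_simpleSwap_mul (i : Fin (n - 1)) (u : Perm (Fin n)) (a : ℕ) :
    rk (simpleSwap i * u) a (i.val + 1) = rk u a (i.val + 2) + occ u (lo i) a := by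
  rw [rk_hi, rk_simpleSwap_mul_of_ne i u a (by omega)]
  simp [occ]

lemma Ascends.occ_le {i : Fin (n - 1)} {u : Perm (Fin n)} (h : Ascends i u) (a : ℕ) :
    occ u (hi i) a ≤ occ u (lo i) a := by
  unfold Ascends at h
  rw [Fin.lt_def] at h
  unfold occ; split_ifs <;> omega

lemma le_occ_of_not_ascends {i : Fin (n - 1)} {u : Perm (Fin n)} (h : ¬ Ascends i u) (a : ℕ) :
    occ u (lo i) a ≤ occ u (hi i) a := by
  unfold Ascends at h
  rw [Fin.lt_def] at h
  unfold occ; split_ifs <;> omega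

lemma RankLE.of_row {i : Fin (n - 1)} {v w : Perm (Fin n)}
    (h : ∀ a, rk v a (i.val + 1) ≤ rk w a (i.val + 1))
    (h' : ∀ a b, b ≠ i.val + 1 → rk v a b ≤ rk w a b) : RankLE v w := by
  intro a b
  by_cases hb : b = i.val + 1
  · subst hb; exact h a
  · exact h' a b hb

/-- A family of numerical facts about the rows `i`, `i + 1`, `i + 2` of two comparable
permutations. -/
lemma RankLE.rows {v w : Perm (Fin n)} (h : RankLE v w) (i : Fin (n - 1)) (a : ℕ) :
    rk v a (i.val + 2) ≤ rk w a (i.val + 2) ∧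
    rk v a (i.val + 2) + occ v (hi i) a ≤ rk w a (i.val + 2) + occ w (hi i) a ∧
    rk v a (i.val + 2) + occ v (hi i) a + occ v (lo i) a ≤
      rk w a (i.val + 2) + occ w (hi i) a + occ w (lo i) a := by
  refine ⟨h _ _, ?_, ?_⟩
  · rw [← rk_hi, ← rk_hi]; exact h _ _
  · rw [← rk_hi, ← rk_hi, ← rk_lo, ← rk_lo]; exact h _ _

lemma Ascends.rankLE {i : Fin (n - 1)} {u : Perm (Fin n)} (h : Ascends i u) :
    RankLE u (simpleSwap i * u) := by
  refine RankLE.of_row (i := i) (fun a => ?_) fun a b hb => ?_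
  · rw [rk_simpleSwap_mul, rk_hi]
    have := h.occ_le a; omega
  · rw [rk_simpleSwap_mul_of_ne i u a hb]

lemma rankLE_of_not_ascends {i : Fin (n - 1)} {u : Perm (Fin n)} (h : ¬ Ascends i u) :
    RankLE (simpleSwap i * u) u := by
  have := ((not_ascends_iff i u).1 h).rankLE
  rwa [simpleSwap_mul_cancel] at this

/-- Lifting: an ascending lower element stays below when the upper one is lowered. -/
lemma RankLE.le_lower {i : Fin (n - 1)} {v w : Perm (Fin n)} (h : RankLE v w)
    (hv : Ascends i v) (hw : ¬ Ascends i w) : RankLE v (simpleSwap i * w) := by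
  refine RankLE.of_row (i := i) (fun a => ?_) fun a b hb => ?_
  -- A failure would force equality in row `i + 2`, with `i + 1` occurring in `v` and `i` not
  -- occurring in `w`. As `v` ascends, both values occur in `v`, which contradicts row `i`.
  · rw [rk_simpleSwap_mul, rk_hi]
    have h1 := h.rows i a
    have h2 := hv.occ_le a
    have h3 := le_occ_of_not_ascends hw a
    have h4 := occ_le_one v (lo i) a
    have h5 := occ_le_one v (hi i) a
    have h6 := occ_le_one w (lo i) a
    have h7 := occ_le_one w (hi i) a
    omega
  · rw [rk_simpleSwap_mul_of_ne i w a hb]; exact h a b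

/-- Lifting: two descending elements may be lowered together. -/
lemma RankLE.lower_lower {i : Fin (n - 1)} {v w : Perm (Fin n)} (h : RankLE v w)
    (hv : ¬ Ascends i v) : RankLE (simpleSwap i * v) (simpleSwap i * w) := by
  refine RankLE.of_row (i := i) (fun a => ?_) fun a b hb => ?_
  · rw [rk_simpleSwap_mul, rk_simpleSwap_mul]
    have h1 := h.rows i a
    have h3 := le_occ_of_not_ascends hv a
    have h4 := occ_le_one v (lo i) a
    have h5 := occ_le_one v (hi i) a
    have h6 := occ_le_one w (lo i) a
    have h7 := occ_le_one w (hi i) a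
    omega
  · rw [rk_simpleSwap_mul_of_ne i w a hb, rk_simpleSwap_mul_of_ne i v a hb]; exact h a b

/-- Lifting: an element may be raised together with an ascending upper bound. -/
lemma RankLE.raise_raise {i : Fin (n - 1)} {v w : Perm (Fin n)} (h : RankLE v w)
    (hw : Ascends i w) : RankLE (simpleSwap i * v) (simpleSwap i * w) := by
  refine RankLE.of_row (i := i) (fun a => ?_) fun a b hb => ?_
  · rw [rk_simpleSwap_mul, rk_simpleSwap_mul]
    have h1 := h.rows i a
    have h3 := hw.occ_le a
    have h4 := occ_le_one v (lo i) a
    have h5 := occ_le_one v (hi i) a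
    have h6 := occ_le_one w (lo i) a
    have h7 := occ_le_one w (hi i) a
    omega
  · rw [rk_simpleSwap_mul_of_ne i w a hb, rk_simpleSwap_mul_of_ne i v a hb]; exact h a b

/-! ### Inversions and reduced words -/

/-- The number of inversions. -/
def inv (u : Perm (Fin n)) : ℕ := #{x : Fin n × Fin n | x.1 < x.2 ∧ u x.2 < u x.1}

lemma simpleSwap_lt_simpleSwap (i : Fin (n - 1)) {x y : Fin n}
    (h : ¬ (x = lo i ∧ y = hi i)) (h' : ¬ (x = hi i ∧ y = lo i)) :
    simpleSwap i x < simpleSwap i y ↔ x < y := by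
  simp only [simpleSwap_apply, Fin.ext_iff, lo_val, hi_val] at *
  rw [Fin.lt_def, Fin.lt_def]
  split_ifs <;> simp <;> omega

/-- The only new inversion is the pair of positions of `i` and `i + 1`; the order of all other pairs
of values is unchanged. -/
lemma inv_simpleSwap_mul {i : Fin (n - 1)} {u : Perm (Fin n)} (h : Ascends i u) :
    inv (simpleSwap i * u) = inv u + 1 := by
  have hset : ({x : Fin n × Fin n | x.1 < x.2 ∧ (simpleSwap i * u) x.2 < (simpleSwap i * u) x.1} :
      Finset (Fin n × Fin n)) =
      insert (u⁻¹ (lo i), u⁻¹ (hi i))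
        ({x : Fin n × Fin n | x.1 < x.2 ∧ u x.2 < u x.1} : Finset (Fin n × Fin n)) := by
    ext ⟨x, y⟩
    rw [mem_filter, mem_insert, mem_filter]
    simp only [mem_univ, true_and, Perm.mul_apply, Prod.mk.injEq]
    by_cases h1 : u x = lo i ∧ u y = hi i
    · have hx : x = u⁻¹ (lo i) := by rw [← h1.1]; simp
      have hy : y = u⁻¹ (hi i) := by rw [← h1.2]; simp
      rw [h1.1, h1.2, simpleSwap_lo, simpleSwap_hi]
      have : lo i < hi i := by rw [Fin.lt_def]; simp
      simp only [hx, hy, this, and_true]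
      exact ⟨fun _ => by simp, fun _ => h⟩
    · have hne : ¬ (x = u⁻¹ (lo i) ∧ y = u⁻¹ (hi i)) := by
        rintro ⟨rfl, rfl⟩; exact h1 (by simp)
      simp only [hne, false_or]
      by_cases h2 : u x = hi i ∧ u y = lo i
      · have hx : x = u⁻¹ (hi i) := by rw [← h2.1]; simp
        have hy : y = u⁻¹ (lo i) := by rw [← h2.2]; simp
        have : ¬ x < y := by rw [hx, hy]; exact lt_asymm h
        simp [this]
      · rw [simpleSwap_lt_simpleSwap]
        · tauto
        · tauto
  unfold inv
  rw [hset, Finset.card_insert_of_notMem]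
  rw [mem_filter]
  rintro ⟨-, -, h'⟩
  simp [Fin.lt_def] at h'

lemma inv_simpleSwap_mul_of_not {i : Fin (n - 1)} {u : Perm (Fin n)} (h : ¬ Ascends i u) :
    inv (simpleSwap i * u) + 1 = inv u := by
  have := inv_simpleSwap_mul ((not_ascends_iff i u).1 h)
  rw [simpleSwap_mul_cancel] at this
  exact this.symm

lemma wordProd_cons (i : Fin (n - 1)) (ω : List (Fin (n - 1))) :
    wordProd (i :: ω) = simpleSwap i * wordProd ω := by
  simp [wordProd]

lemma inv_one : inv (1 : Perm (Fin n)) = 0 := by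
  unfold inv
  rw [Finset.card_eq_zero, Finset.filter_eq_empty_iff]
  rintro ⟨x, y⟩ - ⟨h, h'⟩
  exact lt_asymm h h'

lemma inv_wordProd_le (ω : List (Fin (n - 1))) : inv (wordProd ω) ≤ ω.length := by
  induction ω with
  | nil => simp [wordProd, inv_one]
  | cons i ω ih =>
    rw [wordProd_cons, List.length_cons]
    by_cases h : Ascends i (wordProd ω)
    · rw [inv_simpleSwap_mul h]; omega
    · have := inv_simpleSwap_mul_of_not h; omega

lemma exists_not_ascends {u : Perm (Fin n)} (hu : u ≠ 1) : ∃ i, ¬ Ascends i u := by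
  by_contra! h
  apply hu
  have hmono : StrictMono (u⁻¹ : Perm (Fin n)) := by
    obtain _ | m := n
    · intro x; exact x.elim0
    · rw [Fin.strictMono_iff_lt_succ]
      intro i
      exact h ⟨i.val, by simp⟩
  have h1 : (u⁻¹ : Perm (Fin n)) = 1 := by
    have : ((u⁻¹ : Perm (Fin n)) : Fin n → Fin n) = id :=
      (hmono.range_inj strictMono_id).1 (by rw [(u⁻¹).surjective.range_eq, Set.range_id])
    ext x; simp [this]
  rw [← inv_inv u, h1, _root_.inv_one]

lemma exists_word (u : Perm (Fin n)) :
    ∃ ω : List (Fin (n - 1)), wordProd ω = u ∧ ω.length = inv u := by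
  induction hm : inv u generalizing u with
  | zero =>
    refine ⟨[], ?_, rfl⟩
    by_contra h
    obtain ⟨i, hi⟩ := exists_not_ascends (fun h' => h (by rw [h']; simp [wordProd]) : u ≠ 1)
    have := inv_simpleSwap_mul_of_not hi
    omega
  | succ m ih =>
    have hu : u ≠ 1 := by rintro rfl; rw [inv_one] at hm; omega
    obtain ⟨i, hi⟩ := exists_not_ascends hu
    have := inv_simpleSwap_mul_of_not hi
    obtain ⟨ω, h1, h2⟩ := ih (simpleSwap i * u) (by omega)
    exact ⟨i :: ω, by rw [wordProd_cons, h1, simpleSwap_mul_cancel], by simp [h2]⟩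

/-- One letter changes the number of inversions by one, so no word is shorter than `inv w`; removing
descents one by one attains this length. -/
lemma isReducedWord_iff {ω : List (Fin (n - 1))} {w : Perm (Fin n)} :
    IsReducedWord ω w ↔ wordProd ω = w ∧ ω.length = inv w := by
  constructor
  · rintro ⟨h1, h2⟩
    refine ⟨h1, le_antisymm ?_ ?_⟩
    · obtain ⟨ω', h3, h4⟩ := exists_word w
      exact h4 ▸ h2 ω' h3
    · rw [← h1]; exact inv_wordProd_le ω
  · rintro ⟨h1, h2⟩
    refine ⟨h1, fun ω' h' => ?_⟩
    rw [h2, ← h']; exact inv_wordProd_le ω'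

lemma IsReducedWord.of_cons {i : Fin (n - 1)} {ω : List (Fin (n - 1))} {w : Perm (Fin n)}
    (h : IsReducedWord (i :: ω) w) :
    IsReducedWord ω (wordProd ω) ∧ w = simpleSwap i * wordProd ω ∧ Ascends i (wordProd ω) := by
  rw [isReducedWord_iff, wordProd_cons, List.length_cons] at h
  obtain ⟨h1, h2⟩ := h
  have h3 := inv_wordProd_le ω
  have h4 : Ascends i (wordProd ω) := by
    by_contra h
    have := inv_simpleSwap_mul_of_not h
    rw [h1] at this; omega
  have := inv_simpleSwap_mul h4
  rw [h1] at this
  exact ⟨isReducedWord_iff.2 ⟨rfl, by omega⟩, h1.symm, h4⟩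

lemma IsReducedWord.cons {i : Fin (n - 1)} {ω : List (Fin (n - 1))} {w : Perm (Fin n)}
    (h : IsReducedWord ω (simpleSwap i * w)) (hw : ¬ Ascends i w) : IsReducedWord (i :: ω) w := by
  rw [isReducedWord_iff] at *
  rw [wordProd_cons, h.1, simpleSwap_mul_cancel, List.length_cons, h.2]
  exact ⟨rfl, inv_simpleSwap_mul_of_not hw⟩

/-- Each letter of a reduced word acts on an ascending product: a skipped letter only raises the
upper element, a kept one raises both. -/
lemma rankLE_wordProd_of_sublist {α β : List (Fin (n - 1))} (h : α.Sublist β)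
    (hβ : IsReducedWord β (wordProd β)) : RankLE (wordProd α) (wordProd β) := by
  induction h with
  | slnil => exact RankLE.refl _
  | cons i _ ih =>
    obtain ⟨h1, h2, h3⟩ := hβ.of_cons
    rw [wordProd_cons]
    exact (ih h1).trans h3.rankLE
  | cons_cons i _ ih =>
    obtain ⟨h1, h2, h3⟩ := hβ.of_cons
    rw [wordProd_cons, wordProd_cons]
    exact (ih h1).raise_raise h3

lemma BruhatLE.rankLE {v w : Perm (Fin n)} (h : BruhatLE v w) : RankLE v w := by
  obtain ⟨α, β, hα, hβ, hs⟩ := h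
  obtain rfl := hα.1
  obtain rfl := hβ.1
  exact rankLE_wordProd_of_sublist hs hβ

lemma RankLE.eq_one {v : Perm (Fin n)} (h : RankLE v 1) : v = 1 := by
  by_contra hv
  have key : ∀ m : ℕ, ∀ j : Fin n, j.val < m → v j = j := by
    intro m
    induction m with
    | zero => intro j hj; omega
    | succ m ih =>
      intro j hj
      have hle : (v j).val ≤ j.val := by
        by_contra hlt
        have h5 := h (j.val + 1) (j.val + 1)
        have h6 : rk (1 : Perm (Fin n)) (j.val + 1) (j.val + 1) = 0 := by
          unfold rk
          rw [Finset.card_eq_zero, Finset.filter_eq_empty_iff]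
          rintro j - ⟨h, h'⟩
          simp at h'
          omega
        have h7 : 0 < rk v (j.val + 1) (j.val + 1) := by
          unfold rk
          rw [Finset.card_pos]
          exact ⟨j, by simp; omega⟩
        omega
      by_contra hne
      have hlt : (v j).val < j.val := lt_of_le_of_ne hle fun h => hne (Fin.ext h)
      have := ih (v j) (by omega)
      exact hne (v.injective this)
  exact hv (Equiv.ext fun j => key (j.val + 1) j (by omega))

/-- Induction on inversions at a descent `i` of `w`. If `v` ascends at `i`, it stays below the
lowered `w` and only the upper word receives the letter; otherwise both elements are lowered and
both words receive it. -/
lemma RankLE.bruhatLE {v w : Perm (Fin n)} (h : RankLE v w) : BruhatLE v w := by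
  induction hm : inv w generalizing v w with
  | zero =>
    have hw : w = 1 := by
      by_contra hw
      obtain ⟨i, hi⟩ := exists_not_ascends hw
      have := inv_simpleSwap_mul_of_not hi
      omega
    subst hw
    obtain rfl := h.eq_one
    have : IsReducedWord [] (1 : Perm (Fin n)) := isReducedWord_iff.2 ⟨by simp [wordProd], by simp [inv_one]⟩
    exact ⟨[], [], this, this, List.Sublist.refl _⟩
  | succ m ih =>
    have hw : w ≠ 1 := by rintro rfl; rw [inv_one] at hm; omega
    obtain ⟨i, hi⟩ := exists_not_ascends hw
    have := inv_simpleSwap_mul_of_not hi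
    by_cases hv : Ascends i v
    · obtain ⟨α, β, h1, h2, h3⟩ := ih (h.le_lower hv hi) (by omega)
      exact ⟨α, i :: β, h1, h2.cons hi, h3.cons i⟩
    · obtain ⟨α, β, h1, h2, h3⟩ := ih (h.lower_lower hv) (by omega)
      exact ⟨i :: α, i :: β, h1.cons hv, h2.cons hi, h3.cons_cons i⟩

lemma bruhatLE_iff_rankLE {v w : Perm (Fin n)} : BruhatLE v w ↔ RankLE v w :=
  ⟨BruhatLE.rankLE, RankLE.bruhatLE⟩

lemma wordProd_reverse (ω : List (Fin (n - 1))) : wordProd ω.reverse = (wordProd ω)⁻¹ := by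
  induction ω with
  | nil => simp [wordProd]
  | cons i ω ih =>
    rw [wordProd_cons, mul_inv_rev, ← ih, simpleSwap_inv]
    simp [wordProd]

lemma IsReducedWord.reverse {ω : List (Fin (n - 1))} {w : Perm (Fin n)} (h : IsReducedWord ω w) :
    IsReducedWord ω.reverse w⁻¹ := by
  refine ⟨by rw [wordProd_reverse, h.1], fun ω' h' => ?_⟩
  rw [List.length_reverse, ← List.length_reverse (as := ω')]
  exact h.2 _ (by rw [wordProd_reverse, h', inv_inv])

lemma BruhatLE.inv {v w : Perm (Fin n)} (h : BruhatLE v w) : BruhatLE v⁻¹ w⁻¹ := by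
  obtain ⟨α, β, hα, hβ, hs⟩ := h
  exact ⟨_, _, hα.reverse, hβ.reverse, hs.reverse⟩

/-- The exchange of rows and columns is not visible in the rank inequalities, but it is the reversal
of words. -/
lemma RankLE.inv {v w : Perm (Fin n)} (h : RankLE v w) : RankLE v⁻¹ w⁻¹ :=
  h.bruhatLE.inv.rankLE

/-! ### Exchanging two positions -/

/-- Only the columns `p < a ≤ q` see one of the two positions without the other. The additive form
avoids subtraction in `ℕ`. -/
lemma rk_mul_swap (z : Perm (Fin n)) {p q : Fin n} (hpq : p < q) (a b : ℕ) :
    rk (z * swap p q) a b + (if p.val < a ∧ a ≤ q.val ∧ b ≤ (z p).val then 1 else 0) =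
      rk z a b + (if p.val < a ∧ a ≤ q.val ∧ b ≤ (z q).val then 1 else 0) := by
  have hq : q ∈ (univ : Finset (Fin n)).erase p := by simp [hpq.ne']
  rw [rk_eq_sum, rk_eq_sum, ← Finset.add_sum_erase _ _ (mem_univ p),
    ← Finset.add_sum_erase _ _ hq, ← Finset.add_sum_erase (univ : Finset (Fin n)) _ (mem_univ p),
    ← Finset.add_sum_erase _ _ hq]
  have hrest : ∑ j ∈ ((univ : Finset (Fin n)).erase p).erase q,
        (if j.val < a ∧ b ≤ ((z * swap p q) j).val then 1 else 0) =
      ∑ j ∈ ((univ : Finset (Fin n)).erase p).erase q,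
        (if j.val < a ∧ b ≤ (z j).val then 1 else 0) := by
    refine Finset.sum_congr rfl fun j hj => ?_
    simp only [mem_erase, mem_univ, and_true] at hj
    rw [Perm.mul_apply, swap_apply_of_ne_of_ne hj.2 hj.1]
  rw [hrest]
  simp only [Perm.mul_apply, swap_apply_left, swap_apply_right]
  rw [Fin.lt_def] at hpq
  split_ifs <;> omega

lemma rankLE_mul_swap {z w : Perm (Fin n)} {p q : Fin n} (hpq : p < q) (h : RankLE z w)
    (hr : ∀ a b, p.val < a → a ≤ q.val → (z p).val < b → b ≤ (z q).val → rk z a b < rk w a b) :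
    RankLE (z * swap p q) w := by
  intro a b
  have h1 := rk_mul_swap z hpq a b
  have h2 := h a b
  have h3 := hr a b
  split_ifs at h1 <;> omega

lemma mul_swap_rankLE {z w : Perm (Fin n)} {p q : Fin n} (hpq : p < q) (hz : z q < z p)
    (h : RankLE z w) : RankLE (z * swap p q) w := by
  refine rankLE_mul_swap hpq h fun a b _ _ h1 h2 => ?_
  rw [Fin.lt_def] at hz; omega

lemma rankLE_mul_swap_right {v z : Perm (Fin n)} {p q : Fin n} (hpq : p < q) (h : RankLE v z)
    (hr : ∀ a b, p.val < a → a ≤ q.val → (z q).val < b → b ≤ (z p).val → rk v a b < rk z a b) :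
    RankLE v (z * swap p q) := by
  intro a b
  have h1 := rk_mul_swap z hpq a b
  have h2 := h a b
  have h3 := hr a b
  split_ifs at h1 <;> omega

lemma rankLE_mul_swap_right_of_lt {v z : Perm (Fin n)} {p q : Fin n} (hpq : p < q)
    (hz : z p < z q) (h : RankLE v z) : RankLE v (z * swap p q) := by
  refine rankLE_mul_swap_right hpq h fun a b _ _ h1 h2 => ?_
  rw [Fin.lt_def] at hz; omega

/-! ### Supermodularity of the rank function -/

/-- Inclusion–exclusion over a rectangle. An empty rectangle makes the rank modular for `z`, while
any other permutation remains supermodular; the exchanges below play these off against each other.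
-/
lemma rk_window (z : Perm (Fin n)) {a a' b c : ℕ} (ha : a ≤ a') (hb : b ≤ c) :
    rk z a' b + rk z a c =
      rk z a b + rk z a' c + #{j : Fin n | a ≤ j.val ∧ j.val < a' ∧ b ≤ (z j).val ∧ (z j).val < c} := by
  rw [Finset.card_filter]
  simp only [rk_eq_sum, ← Finset.sum_add_distrib]
  refine Finset.sum_congr rfl fun j _ => ?_
  split_ifs <;> omega

lemma rk_supermodular (z : Perm (Fin n)) {a a' b c : ℕ} (ha : a ≤ a') (hb : b ≤ c) :
    rk z a b + rk z a' c ≤ rk z a' b + rk z a c := by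
  have := rk_window z ha hb; omega

lemma rk_modular (z : Perm (Fin n)) {a a' b c : ℕ} (ha : a ≤ a') (hb : b ≤ c)
    (h : ∀ j : Fin n, a ≤ j.val → j.val < a' → b ≤ (z j).val → c ≤ (z j).val) :
    rk z a b + rk z a' c = rk z a' b + rk z a c := by
  have h1 := rk_window z ha hb
  have h2 : #{j : Fin n | a ≤ j.val ∧ j.val < a' ∧ b ≤ (z j).val ∧ (z j).val < c} = 0 := by
    rw [Finset.card_eq_zero, Finset.filter_eq_empty_iff]
    rintro j - ⟨h3, h4, h5, h6⟩
    have := h j h3 h4 h5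
    omega
  omega

/-! ### Four exchanges that stay inside an interval -/

section exchanges

variable {i : Fin (n - 1)} {v z w : Perm (Fin n)}

/-- The exchange raises ranks on a rectangle whose top row is `i + 1`. Maximality of `z p` empties
the window between column `a₁` and the column considered, so slack in row `i + 1`, with tightness at
`a₁`, propagates down to the lower rows. -/
lemma exchange_hi_raise (h : RankLE z w) {a₁ : ℕ} {p q : Fin n} (hq : z q = hi i)
    (ht : rk w a₁ (i.val + 1) = rk z a₁ (i.val + 1))
    (hs : ∀ a, a₁ < a → a ≤ q.val → rk z a (i.val + 1) < rk w a (i.val + 1))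
    (hp : a₁ ≤ p.val) (hpq : p < q)
    (hmax : ∀ j : Fin n, a₁ ≤ j.val → j < q → (z j).val ≤ i.val → z j ≤ z p) :
    RankLE (z * swap p q) w := by
  refine rankLE_mul_swap hpq h fun a b h1 h2 h3 h4 => ?_
  rw [hq, hi_val] at h4
  have h5 := hs a (by omega) h2
  have h6 := rk_modular z (a := a₁) (a' := a) (b := b) (c := i.val + 1) (by omega) h4
    fun j hj hj' hb => by
      by_contra hc
      have := Fin.le_def.1 (hmax j hj (Fin.lt_def.2 (by omega)) (by omega))
      omega
  have h7 := rk_supermodular w (a := a₁) (a' := a) (b := b) (c := i.val + 1) (by omega) h4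
  have h8 := h a₁ b
  omega

/-- The mirror image: slack in row `i + 1` propagates up to higher rows, with tightness at the right
end `a₂`. -/
lemma exchange_lo_raise (h : RankLE z w) {a₂ : ℕ} {p q : Fin n} (hp : z p = lo i)
    (ht : rk w a₂ (i.val + 1) = rk z a₂ (i.val + 1))
    (hs : ∀ a, p.val < a → a < a₂ → rk z a (i.val + 1) < rk w a (i.val + 1))
    (hpq : p < q) (hq : q.val < a₂)
    (hmin : ∀ j : Fin n, p < j → j.val < a₂ → i.val + 1 ≤ (z j).val → z q ≤ z j) :
    RankLE (z * swap p q) w := by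
  refine rankLE_mul_swap hpq h fun a b h1 h2 h3 h4 => ?_
  rw [hp, lo_val] at h3
  have h5 := hs a h1 (by omega)
  have h6 := rk_modular z (a := a) (a' := a₂) (b := i.val + 1) (c := b) (by omega) h3
    fun j hj hj' hb => by
      have := Fin.le_def.1 (hmin j (Fin.lt_def.2 (by omega)) hj' hb)
      omega
  have h7 := rk_supermodular w (a := a) (a' := a₂) (b := i.val + 1) (c := b) (by omega) h3
  have h8 := h a₂ b
  omega

/-- Where `z` dominates the lowered `v` but not `v` itself, the slack is at most one, so the
neighbouring rows are tight and all four occurrences are determined. -/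
lemma violation_data (h : RankLE (simpleSwap i * v) z) {a : ℕ}
    (ha : rk z a (i.val + 1) < rk v a (i.val + 1)) :
    occ v (hi i) a = 1 ∧ occ v (lo i) a = 0 ∧ occ z (lo i) a = 1 ∧ occ z (hi i) a = 0 ∧
      rk v a i.val = rk z a i.val ∧ rk v a (i.val + 2) = rk z a (i.val + 2) := by
  have h1 := h a i.val
  have h2 := h a (i.val + 1)
  have h3 := h a (i.val + 2)
  rw [rk_simpleSwap_mul_of_ne i v a (by omega)] at h1 h3
  rw [rk_simpleSwap_mul, rk_hi] at h2
  rw [rk_hi, rk_hi] at ha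
  have e1 := rk_lo v i a
  have e2 := rk_lo z i a
  rw [rk_hi] at e1 e2
  have o1 := occ_le_one v (lo i) a
  have o2 := occ_le_one v (hi i) a
  have o3 := occ_le_one z (lo i) a
  have o4 := occ_le_one z (hi i) a
  omega

lemma occ_eq_one {u : Perm (Fin n)} {x : Fin n} {a : ℕ} (h : occ u x a = 1) :
    (u⁻¹ x).val < a := by
  unfold occ at h; split_ifs at h; assumption

lemma occ_eq_zero {u : Perm (Fin n)} {x : Fin n} {a : ℕ} (h : occ u x a = 0) :
    a ≤ (u⁻¹ x).val := by
  unfold occ at h; split_ifs at h; omega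

/-- Left of the first violation `a₀`, after position `p`, the value `i` has occurred in `z` but not
in `v`, which gives slack in row `i`. This row is tight at `a₀`, and the empty window carries the
slack to the lower rows. -/
lemma exchange_lo_lower (h : RankLE (simpleSwap i * v) z) {a₀ : ℕ} {p q : Fin n} (hp : z p = lo i)
    (ha : rk z a₀ (i.val + 1) < rk v a₀ (i.val + 1))
    (hmin : ∀ a, a < a₀ → rk v a (i.val + 1) ≤ rk z a (i.val + 1))
    (hpq : p < q) (hq : q.val < a₀)
    (hmax : ∀ j : Fin n, p < j → j.val < a₀ → (z j).val < i.val → z j ≤ z q) :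
    RankLE (simpleSwap i * v) (z * swap p q) := by
  obtain ⟨d1, d2, d3, d4, d5, d6⟩ := violation_data h ha
  have hp' : z⁻¹ (lo i) = p := by rw [← hp]; simp
  have d2' := occ_eq_zero d2
  have d4' := occ_eq_zero d4
  refine rankLE_mul_swap_right hpq h fun a b h1 h2 h3 h4 => ?_
  rw [hp, lo_val] at h4
  rw [rk_simpleSwap_mul_of_ne i v a (by omega)]
  have hi0 : rk v a i.val < rk z a i.val := by
    have h5 := hmin a (by omega)
    have e1 := rk_lo v i a
    have e2 := rk_lo z i a
    have e3 : occ v (lo i) a = 0 := by unfold occ; rw [if_neg]; omega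
    have e4 : occ z (lo i) a = 1 := by unfold occ; rw [hp', if_pos h1]
    omega
  have h6 := rk_modular z (a := a) (a' := a₀) (b := b) (c := i.val) (by omega) h4
    fun j hj hj' hb => by
      by_contra hc
      have := Fin.le_def.1 (hmax j (Fin.lt_def.2 (by omega)) hj' (by omega))
      omega
  have h7 := rk_supermodular v (a := a) (a' := a₀) (b := b) (c := i.val) (by omega) h4
  have h8 := h a₀ b
  rw [rk_simpleSwap_mul_of_ne i v a₀ (by omega)] at h8
  omega

/-- The mirror image right of the last violation, with slack in row `i + 2` carried to higher rows.
-/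
lemma exchange_hi_lower (h : RankLE (simpleSwap i * v) z) {a₀ : ℕ} {p q : Fin n} (hq : z q = hi i)
    (ha : rk z a₀ (i.val + 1) < rk v a₀ (i.val + 1))
    (hmax : ∀ a, a₀ < a → rk v a (i.val + 1) ≤ rk z a (i.val + 1))
    (hpq : p < q) (hp : a₀ ≤ p.val)
    (hmin : ∀ j : Fin n, a₀ ≤ j.val → j < q → i.val + 1 < (z j).val → z p ≤ z j) :
    RankLE (simpleSwap i * v) (z * swap p q) := by
  obtain ⟨d1, d2, d3, d4, d5, d6⟩ := violation_data h ha
  have hq' : z⁻¹ (hi i) = q := by rw [← hq]; simp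
  have d1' := occ_eq_one d1
  refine rankLE_mul_swap_right hpq h fun a b h1 h2 h3 h4 => ?_
  rw [hq, hi_val] at h3
  rw [rk_simpleSwap_mul_of_ne i v a (by omega)]
  have hi0 : rk v a (i.val + 2) < rk z a (i.val + 2) := by
    have h5 := hmax a (by omega)
    have e1 := rk_hi v i a
    have e2 := rk_hi z i a
    have e3 : occ v (hi i) a = 1 := by unfold occ; rw [if_pos]; omega
    have e4 : occ z (hi i) a = 0 := by unfold occ; rw [hq', if_neg]; omega
    omega
  have h6 := rk_modular z (a := a₀) (a' := a) (b := i.val + 2) (c := b) (by omega) (by omega)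
    fun j hj hj' hb => by
      have := Fin.le_def.1 (hmin j hj (Fin.lt_def.2 (by omega)) (by omega))
      omega
  have h7 := rk_supermodular v (a := a₀) (a' := a) (b := i.val + 2) (c := b) (by omega) (by omega)
  have h8 := h a₀ b
  rw [rk_simpleSwap_mul_of_ne i v a₀ (by omega)] at h8
  omega

end exchanges

/-! ### Initial segments of permutations -/

/-- The set of the first `k` values of `u`. -/
def pre (u : Perm (Fin n)) (k : ℕ) : Set (Fin n) := {x | (u⁻¹ x).val < k}

lemma mem_pre {u : Perm (Fin n)} {k : ℕ} {x : Fin n} : x ∈ pre u k ↔ (u⁻¹ x).val < k := Iff.rfl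

lemma pre_mul_swap (z : Perm (Fin n)) {p q : Fin n} {k : ℕ} (h : p.val < k ↔ q.val < k) :
    pre (z * swap p q) k = pre z k := by
  ext x
  rw [mem_pre, mem_pre, mul_inv_rev, swap_inv, Perm.mul_apply, swap_apply_def]
  split_ifs with h1 h2
  · rw [h1, h]
  · rw [h2, h]
  · rfl

lemma mem_pre_simpleSwap_mul {i : Fin (n - 1)} {u : Perm (Fin n)} {k : ℕ} {x : Fin n} :
    x ∈ pre (simpleSwap i * u) k ↔ simpleSwap i x ∈ pre u k := by
  rw [mem_pre, mem_pre, mul_inv_rev, simpleSwap_inv, Perm.mul_apply]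

lemma pre_simpleSwap_mul_of_iff {i : Fin (n - 1)} {u : Perm (Fin n)} {k : ℕ}
    (h : lo i ∈ pre u k ↔ hi i ∈ pre u k) : pre (simpleSwap i * u) k = pre u k := by
  ext x
  rw [mem_pre_simpleSwap_mul, simpleSwap_apply]
  split_ifs with h1 h2
  · rw [h1, h]
  · rw [h2, h]
  · rfl

lemma rk_col_succ (u : Perm (Fin n)) (j : Fin n) (b : ℕ) :
    rk u (j.val + 1) b = rk u j.val b + if b ≤ (u j).val then 1 else 0 := by
  have : (if b ≤ (u j).val then 1 else 0) =
      ∑ l : Fin n, if l = j ∧ b ≤ (u l).val then 1 else 0 := by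
    rw [Finset.sum_eq_single j] <;> simp +contextual
  rw [this, rk_eq_sum, rk_eq_sum, ← Finset.sum_add_distrib]
  refine Finset.sum_congr rfl fun l _ => ?_
  simp only [Fin.ext_iff]
  split_ifs <;> omega

lemma rk_mono_left (u : Perm (Fin n)) {a a' : ℕ} (h : a ≤ a') (b : ℕ) : rk u a b ≤ rk u a' b :=
  Finset.card_le_card fun j hj => by simp only [mem_filter] at *; exact ⟨hj.1, by omega, hj.2.2⟩

/-- If all intermediate values of `z` were large, its rank would grow by one per column and `w`
could not overtake it. -/
lemma exists_small_of_lt {z w : Perm (Fin n)} {a a' b : ℕ} (h : a ≤ a') (hn : a' ≤ n)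
    (ht : rk w a b = rk z a b) (hs : rk z a' b < rk w a' b) :
    ∃ j : Fin n, a ≤ j.val ∧ j.val < a' ∧ (z j).val < b := by
  by_contra! hc
  induction a', h using Nat.le_induction with
  | base => omega
  | succ m hm ih =>
    have h1 := rk_col_succ z ⟨m, by omega⟩ b
    have h2 := rk_col_succ w ⟨m, by omega⟩ b
    rw [if_pos (hc ⟨m, by omega⟩ hm (by simp))] at h1
    simp only at h1 h2
    refine ih (by omega) ?_ fun j h3 h4 => hc j h3 (by omega)
    split_ifs at h2 <;> omega

lemma exists_large_of_lt {z w : Perm (Fin n)} {a a' b : ℕ} (h : a ≤ a') (hn : a' ≤ n)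
    (ht : rk w a' b = rk z a' b) (hs : rk z a b < rk w a b) :
    ∃ j : Fin n, a ≤ j.val ∧ j.val < a' ∧ b ≤ (z j).val := by
  by_contra! hc
  have h1 : rk z a' b = rk z a b := by
    clear ht
    induction a', h using Nat.le_induction with
    | base => rfl
    | succ m hm ih =>
      have h1 := rk_col_succ z ⟨m, by omega⟩ b
      rw [if_neg (by have := hc ⟨m, by omega⟩ hm (by simp); omega)] at h1
      simp only at h1
      rw [h1, ih (by omega) fun j h3 h4 => hc j h3 (by omega)]; rfl
  have := rk_mono_left w h b
  omega

/-- Among the elements with prescribed initial segment between `simpleSwap i * v` and `w`, the one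
with the values `i` and `i + 1` closest together, or its raised version, lies in `[v, w]`. -/
lemma exists_extremal {i : Fin (n - 1)} {v w z₀ : Perm (Fin n)} (k : ℕ)
    (hvw : RankLE v w) (h₀ : RankLE (simpleSwap i * v) z₀)
    (h₀w : RankLE z₀ w) (hz₀ : Ascends i z₀) :
    ∃ z, pre z k = pre z₀ k ∧ RankLE (simpleSwap i * v) z ∧ RankLE z w ∧ Ascends i z ∧
      (RankLE v z ∨ RankLE (simpleSwap i * z) w) := by
  classical
  obtain ⟨z, hzmem, hzmin⟩ := Finset.exists_min_image
    ({z | pre z k = pre z₀ k ∧ RankLE (simpleSwap i * v) z ∧ RankLE z w ∧ Ascends i z} :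
      Finset (Perm (Fin n))) (fun z => (z⁻¹ (hi i)).val - (z⁻¹ (lo i)).val)
    ⟨z₀, by simp [h₀, h₀w, hz₀]⟩
  simp only [mem_filter, mem_univ, true_and] at hzmem hzmin
  obtain ⟨hpre, hsv, hzw, hasc⟩ := hzmem
  refine ⟨z, hpre, hsv, hzw, hasc, ?_⟩
  by_contra! hcon
  obtain ⟨hcv, hcw⟩ := hcon
  obtain ⟨p₀, hp₀⟩ : ∃ p, p = z⁻¹ (lo i) := ⟨_, rfl⟩
  obtain ⟨q₀, hq₀⟩ : ∃ q, q = z⁻¹ (hi i) := ⟨_, rfl⟩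
  have hzp₀ : z p₀ = lo i := by rw [hp₀]; simp
  have hzq₀ : z q₀ = hi i := by rw [hq₀]; simp
  have hpq₀ : p₀ < q₀ := by rw [hp₀, hq₀]; exact hasc
  have hpq₀' := Fin.lt_def.1 hpq₀
  -- By minimality no exchange within one side of the cut `k` can bring `i` and `i + 1` closer while
  -- staying between the bounds.
  have move_lo : ∀ q : Fin n, p₀ < q → q < q₀ → (p₀.val < k ↔ q.val < k) →
      RankLE (simpleSwap i * v) (z * swap p₀ q) → ¬ RankLE (z * swap p₀ q) w := by
    intro q h1 h2 h3 h4 h5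
    have e1 : (z * swap p₀ q)⁻¹ (lo i) = q := by
      rw [mul_inv_rev, swap_inv, Perm.mul_apply, ← hp₀, swap_apply_left]
    have e2 : (z * swap p₀ q)⁻¹ (hi i) = q₀ := by
      rw [mul_inv_rev, swap_inv, Perm.mul_apply, ← hq₀, swap_apply_of_ne_of_ne hpq₀.ne' h2.ne']
    have := hzmin _ ⟨(pre_mul_swap z h3).trans hpre, h4, h5, by
      unfold Ascends; rw [e1, e2]; exact h2⟩
    rw [e1, e2, ← hp₀, ← hq₀] at this
    rw [Fin.lt_def] at h1 h2
    omega
  have move_hi : ∀ p : Fin n, p₀ < p → p < q₀ → (p.val < k ↔ q₀.val < k) →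
      RankLE (simpleSwap i * v) (z * swap p q₀) → ¬ RankLE (z * swap p q₀) w := by
    intro p h1 h2 h3 h4 h5
    have e1 : (z * swap p q₀)⁻¹ (lo i) = p₀ := by
      rw [mul_inv_rev, swap_inv, Perm.mul_apply, ← hp₀, swap_apply_of_ne_of_ne h1.ne hpq₀.ne]
    have e2 : (z * swap p q₀)⁻¹ (hi i) = p := by
      rw [mul_inv_rev, swap_inv, Perm.mul_apply, ← hq₀, swap_apply_right]
    have := hzmin _ ⟨(pre_mul_swap z h3).trans hpre, h4, h5, by
      unfold Ascends; rw [e1, e2]; exact h1⟩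
    rw [e1, e2, ← hp₀, ← hq₀] at this
    rw [Fin.lt_def] at h1 h2
    omega
  -- the columns in which `z` fails to dominate `v`
  have hviol : ∀ a, rk z a (i.val + 1) < rk v a (i.val + 1) → p₀.val < a ∧ a ≤ q₀.val := by
    intro a ha
    obtain ⟨-, -, h3, h4, -, -⟩ := violation_data hsv ha
    have h3 := occ_eq_one h3
    have h4 := occ_eq_zero h4
    rw [← hp₀] at h3
    rw [← hq₀] at h4
    exact ⟨h3, h4⟩
  let V : Finset ℕ := (range (n + 1)).filter fun a => rk z a (i.val + 1) < rk v a (i.val + 1)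
  have memV : ∀ a, a ∈ V ↔ rk z a (i.val + 1) < rk v a (i.val + 1) := by
    intro a
    simp only [V, mem_filter, mem_range, and_iff_right_iff_imp]
    intro ha
    have := hviol a ha
    omega
  have hV : V.Nonempty := by
    by_contra hne
    rw [Finset.not_nonempty_iff_eq_empty] at hne
    refine hcv (RankLE.of_row (i := i) (fun a => ?_) fun a b hb => ?_)
    · by_contra! h
      have := (memV a).2 h
      rw [hne] at this
      simp at this
    · rw [← rk_simpleSwap_mul_of_ne i v a hb]; exact hsv a b
  -- the columns in which raising `z` is obstructed by `w`
  let T : Finset ℕ := (range (n + 1)).filter fun a =>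
    p₀.val < a ∧ a ≤ q₀.val ∧ rk w a (i.val + 1) = rk z a (i.val + 1)
  have memT : ∀ a, a ∈ T ↔ p₀.val < a ∧ a ≤ q₀.val ∧ rk w a (i.val + 1) = rk z a (i.val + 1) := by
    intro a
    simp only [T, mem_filter, mem_range, and_iff_right_iff_imp]
    intro ha
    omega
  have hT : T.Nonempty := by
    by_contra hne
    rw [Finset.not_nonempty_iff_eq_empty] at hne
    refine hcw (RankLE.of_row (i := i) (fun a => ?_) fun a b hb => ?_)
    · by_contra! h
      have h1 := hzw a (i.val + 1)
      rw [rk_simpleSwap_mul] at h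
      have h2 := rk_hi z i a
      have h3 := occ_le_one z (lo i) a
      have h4 : occ z (lo i) a = 1 := by omega
      have h5 : occ z (hi i) a = 0 := by omega
      have h6 := occ_eq_one h4
      have h7 := occ_eq_zero h5
      rw [← hp₀] at h6
      rw [← hq₀] at h7
      have := (memT a).2 ⟨h6, h7, by omega⟩
      rw [hne] at this
      simp at this
    · rw [rk_simpleSwap_mul_of_ne i z a hb]; exact hzw a b
  have slackT : ∀ a, p₀.val < a → a ≤ q₀.val → a ∉ T →
      rk z a (i.val + 1) < rk w a (i.val + 1) := by
    intro a h1 h2 h3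
    rw [memT] at h3
    have := hzw a (i.val + 1)
    by_contra h
    exact h3 ⟨h1, h2, by omega⟩
  have slackV : ∀ a, a ∈ V → rk z a (i.val + 1) < rk w a (i.val + 1) := by
    intro a ha
    exact lt_of_lt_of_le ((memV a).1 ha) (hvw a _)
  obtain ⟨b₀, hb₀⟩ : ∃ b, b = V.min' hV := ⟨_, rfl⟩
  obtain ⟨b₁, hb₁⟩ : ∃ b, b = V.max' hV := ⟨_, rfl⟩
  obtain ⟨t₀, ht₀⟩ : ∃ b, b = T.min' hT := ⟨_, rfl⟩
  obtain ⟨t₁, ht₁⟩ : ∃ b, b = T.max' hT := ⟨_, rfl⟩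
  have b₀V : b₀ ∈ V := hb₀ ▸ V.min'_mem hV
  have b₁V : b₁ ∈ V := hb₁ ▸ V.max'_mem hV
  have t₀T : t₀ ∈ T := ht₀ ▸ T.min'_mem hT
  have t₁T : t₁ ∈ T := ht₁ ▸ T.max'_mem hT
  have b₀min : ∀ a, a < b₀ → rk v a (i.val + 1) ≤ rk z a (i.val + 1) := by
    intro a ha
    by_contra! h
    have := V.min'_le a ((memV a).2 h)
    omega
  have b₁max : ∀ a, b₁ < a → rk v a (i.val + 1) ≤ rk z a (i.val + 1) := by
    intro a ha
    by_contra! h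
    have := V.le_max' a ((memV a).2 h)
    omega
  have t₀min : ∀ a, a < t₀ → a ∉ T := by
    intro a ha h
    have := T.min'_le a h
    omega
  have t₁max : ∀ a, t₁ < a → a ∉ T := by
    intro a ha h
    have := T.le_max' a h
    omega
  have hb : b₀ ≤ b₁ := hb₀ ▸ V.min'_le _ b₁V
  have ht : t₀ ≤ t₁ := ht₀ ▸ T.min'_le _ t₁T
  have c₀ := hviol b₀ ((memV _).1 b₀V)
  have c₁ := hviol b₁ ((memV _).1 b₁V)
  have d₀ := (memT _).1 t₀T
  have d₁ := (memT _).1 t₁T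
  have s₀ := slackV b₀ b₀V
  have s₁ := slackV b₁ b₁V
  -- A column violated by `v` cannot be tight for `w`, since `v` is below `w`.
  have ne₀ : t₀ ≠ b₀ := by rintro rfl; omega
  have ne₁ : t₁ ≠ b₁ := by rintro rfl; omega
  -- According to which of the last tight and last violated columns comes first, a raising or a
  -- lowering exchange moves `i + 1` to the left. Minimality leaves only the possibility that the
  -- exchange crosses the cut `k`. The next claim does the same for `i` on the left.
  have right : (t₁ < b₁ ∧ ∃ p : Fin n, t₁ ≤ p.val ∧ p < q₀ ∧ (z p).val ≤ i.val ∧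
        (∀ j : Fin n, t₁ ≤ j.val → j < q₀ → (z j).val ≤ i.val → z j ≤ z p) ∧
        p.val < k ∧ k ≤ q₀.val) ∨
      (b₁ < t₁ ∧ ∃ p : Fin n, b₁ ≤ p.val ∧ p < q₀ ∧ i.val + 1 < (z p).val ∧
        (∀ j : Fin n, b₁ ≤ j.val → j < q₀ → i.val + 1 < (z j).val → z p ≤ z j) ∧
        p.val < k ∧ k ≤ q₀.val) := by
    rcases lt_or_gt_of_ne ne₁ with hlt | hlt
    · refine Or.inl ⟨hlt, ?_⟩
      obtain ⟨j, j1, j2, j3⟩ := exists_small_of_lt hlt.le (by omega) d₁.2.2 s₁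
      obtain ⟨p, hp, hpmax⟩ := Finset.exists_max_image
        ({j : Fin n | t₁ ≤ j.val ∧ j < q₀ ∧ (z j).val ≤ i.val} : Finset (Fin n)) (fun j => z j)
        ⟨j, by simp only [mem_filter, mem_univ, true_and]
               exact ⟨j1, Fin.lt_def.2 (by omega), by omega⟩⟩
      simp only [mem_filter, mem_univ, true_and, and_imp] at hp hpmax
      refine ⟨p, hp.1, hp.2.1, hp.2.2, hpmax, ?_⟩
      have hpq := Fin.lt_def.1 hp.2.1
      by_contra hk
      refine move_hi p (Fin.lt_def.2 (by omega)) hp.2.1 (by omega)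
        (rankLE_mul_swap_right_of_lt hp.2.1 ?_ hsv)
        (exchange_hi_raise hzw hzq₀ d₁.2.2 (fun a h1 h2 => slackT a (by omega) h2 (t₁max a h1))
          hp.1 hp.2.1 hpmax)
      rw [hzq₀, Fin.lt_def, hi_val]; omega
    · refine Or.inr ⟨hlt, ?_⟩
      obtain ⟨j, j1, j2, j3⟩ := exists_large_of_lt hlt.le (by omega) d₁.2.2 s₁
      have hj : (z j).val ≠ i.val + 1 := by
        intro h
        have : z j = z q₀ := by rw [hzq₀]; exact Fin.ext h
        have := z.injective this
        rw [this] at j2; omega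
      obtain ⟨p, hp, hpmin⟩ := Finset.exists_min_image
        ({j : Fin n | b₁ ≤ j.val ∧ j < q₀ ∧ i.val + 1 < (z j).val} : Finset (Fin n)) (fun j => z j)
        ⟨j, by simp only [mem_filter, mem_univ, true_and]
               exact ⟨j1, Fin.lt_def.2 (by omega), by omega⟩⟩
      simp only [mem_filter, mem_univ, true_and, and_imp] at hp hpmin
      refine ⟨p, hp.1, hp.2.1, hp.2.2, hpmin, ?_⟩
      have hpq := Fin.lt_def.1 hp.2.1
      by_contra hk
      refine move_hi p (Fin.lt_def.2 (by omega)) hp.2.1 (by omega)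
        (exchange_hi_lower hsv hzq₀ ((memV _).1 b₁V) b₁max hp.2.1 hp.1 hpmin)
        (mul_swap_rankLE hp.2.1 ?_ hzw)
      rw [hzq₀, Fin.lt_def, hi_val]; omega
  have left : (b₀ < t₀ ∧ ∃ q : Fin n, p₀ < q ∧ q.val < t₀ ∧ i.val + 1 ≤ (z q).val ∧
        (∀ j : Fin n, p₀ < j → j.val < t₀ → i.val + 1 ≤ (z j).val → z q ≤ z j) ∧
        p₀.val < k ∧ k ≤ q.val) ∨
      (t₀ < b₀ ∧ ∃ q : Fin n, p₀ < q ∧ q.val < b₀ ∧ (z q).val < i.val ∧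
        (∀ j : Fin n, p₀ < j → j.val < b₀ → (z j).val < i.val → z j ≤ z q) ∧
        p₀.val < k ∧ k ≤ q.val) := by
    rcases lt_or_gt_of_ne ne₀ with hlt | hlt
    · refine Or.inr ⟨hlt, ?_⟩
      obtain ⟨j, j1, j2, j3⟩ := exists_small_of_lt hlt.le (by omega) d₀.2.2 s₀
      have hj : (z j).val ≠ i.val := by
        intro h
        have : z j = z p₀ := by rw [hzp₀]; exact Fin.ext h
        have := z.injective this
        rw [this] at j1; omega
      obtain ⟨q, hq, hqmax⟩ := Finset.exists_max_image
        ({j : Fin n | p₀ < j ∧ j.val < b₀ ∧ (z j).val < i.val} : Finset (Fin n)) (fun j => z j)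
        ⟨j, by simp only [mem_filter, mem_univ, true_and]
               exact ⟨Fin.lt_def.2 (by omega), j2, by omega⟩⟩
      simp only [mem_filter, mem_univ, true_and, and_imp] at hq hqmax
      refine ⟨q, hq.1, hq.2.1, hq.2.2, hqmax, ?_⟩
      have hpq := Fin.lt_def.1 hq.1
      by_contra hk
      have hqq : q < q₀ := by
        rw [Fin.lt_def]; omega
      refine move_lo q hq.1 hqq (by omega)
        (exchange_lo_lower hsv hzp₀ ((memV _).1 b₀V) b₀min hq.1 hq.2.1 hqmax)
        (mul_swap_rankLE hq.1 ?_ hzw)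
      rw [hzp₀, Fin.lt_def, lo_val]; omega
    · refine Or.inl ⟨hlt, ?_⟩
      obtain ⟨j, j1, j2, j3⟩ := exists_large_of_lt hlt.le (by omega) d₀.2.2 s₀
      obtain ⟨q, hq, hqmin⟩ := Finset.exists_min_image
        ({j : Fin n | p₀ < j ∧ j.val < t₀ ∧ i.val + 1 ≤ (z j).val} : Finset (Fin n)) (fun j => z j)
        ⟨j, by simp only [mem_filter, mem_univ, true_and]
               exact ⟨Fin.lt_def.2 (by omega), j2, by omega⟩⟩
      simp only [mem_filter, mem_univ, true_and, and_imp] at hq hqmin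
      refine ⟨q, hq.1, hq.2.1, hq.2.2, hqmin, ?_⟩
      have hpq := Fin.lt_def.1 hq.1
      by_contra hk
      have hqq : q < q₀ := by
        rw [Fin.lt_def]; omega
      refine move_lo q hq.1 hqq (by omega)
        (rankLE_mul_swap_right_of_lt hq.1 ?_ hsv)
        (exchange_lo_raise hzw hzp₀ d₀.2.2
          (fun a h1 h2 => slackT a h1 (by omega) (t₀min a h2)) hq.1 hq.2.1 hqmin)
      rw [hzp₀, Fin.lt_def, lo_val]; omega
  have hzne : ∀ j : Fin n, j ≠ p₀ → (z j).val ≠ i.val := fun j hj h =>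
    hj (z.injective (by rw [hzp₀]; exact Fin.ext h))
  have hzne' : ∀ j : Fin n, j ≠ q₀ → (z j).val ≠ i.val + 1 := fun j hj h =>
    hj (z.injective (by rw [hzq₀]; exact Fin.ext h))
  -- Both exchanges cross the cut, so `p < k ≤ q`. In the outer cases the windows are disjoint and
  -- in the wrong order. In the mixed ones `p` and `q` lie in both windows and are extremal in the
  -- same sense, so they coincide.
  rcases right with ⟨r0, p, r1, r2, r3, r4, r5, r6⟩ | ⟨r0, p, r1, r2, r3, r4, r5, r6⟩ <;>
  rcases left with ⟨l0, q, l1, l2, l3, l4, l5, l6⟩ | ⟨l0, q, l1, l2, l3, l4, l5, l6⟩ <;>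
  rw [Fin.lt_def] at r2 l1
  · omega
  · have e1 := hzne p (Fin.ne_of_val_ne (by omega))
    have e2 := Fin.le_def.1 (r4 q (by omega) (Fin.lt_def.2 (by omega)) (by omega))
    have e3 := Fin.le_def.1 (l4 p (Fin.lt_def.2 (by omega)) (by omega) (by omega))
    have e4 : q = p := z.injective (Fin.ext (by omega))
    rw [e4] at l6; omega
  · have e1 := hzne' q (Fin.ne_of_val_ne (by omega))
    have e2 := Fin.le_def.1 (r4 q (by omega) (Fin.lt_def.2 (by omega)) (by omega))
    have e3 := Fin.le_def.1 (l4 p (Fin.lt_def.2 (by omega)) (by omega) (by omega))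
    have e4 : q = p := z.injective (Fin.ext (by omega))
    rw [e4] at l6; omega
  · omega

/-- Every initial segment of an element of `[v, simpleSwap i * w]` comes from `[v, w]`, either
directly or by replacing `i` with `i + 1`. -/
lemma exists_pre_eq_or {i : Fin (n - 1)} {v w u : Perm (Fin n)} (k : ℕ) (hw : Ascends i w)
    (hvw : RankLE v w) (hvu : RankLE v u) (huw : RankLE u (simpleSwap i * w)) :
    ∃ y, RankLE v y ∧ RankLE y w ∧ (pre y k = pre u k ∨
      (hi i ∈ pre u k ∧ lo i ∉ pre u k ∧ pre y k = pre (simpleSwap i * u) k)) := by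
  have hsw : ¬ Ascends i (simpleSwap i * w) := by
    rw [not_ascends_iff, simpleSwap_mul_cancel]; exact hw
  by_cases hu : Ascends i u
  · refine ⟨u, hvu, ?_, Or.inl rfl⟩
    have := huw.le_lower hu hsw
    rwa [simpleSwap_mul_cancel] at this
  have hsu : Ascends i (simpleSwap i * u) := (not_ascends_iff i u).1 hu
  have hsuw : RankLE (simpleSwap i * u) w := by
    have := huw.lower_lower hu
    rwa [simpleSwap_mul_cancel] at this
  have hcase : ∀ y, pre y k = pre (simpleSwap i * u) k → pre y k = pre u k ∨
      (hi i ∈ pre u k ∧ lo i ∉ pre u k ∧ pre y k = pre (simpleSwap i * u) k) := by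
    intro y hy
    by_cases h : lo i ∈ pre u k ↔ hi i ∈ pre u k
    · left; rw [hy, pre_simpleSwap_mul_of_iff h]
    · right
      have h1 : lo i ∈ pre u k → hi i ∈ pre u k := by
        unfold Ascends at hu
        rw [Fin.lt_def] at hu
        rw [mem_pre, mem_pre]; omega
      tauto
  by_cases hv : Ascends i v
  · refine ⟨_, ?_, hsuw, hcase _ rfl⟩
    exact hvu.le_lower hv hu
  -- The lowered `u` need not dominate `v`; it is replaced by an element with the same first `k`
  -- values.
  · obtain ⟨z, h1, h2, h3, h4, h5⟩ := exists_extremal k hvw (hvu.lower_lower hv) hsuw hsu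
    rcases h5 with h5 | h5
    · exact ⟨z, h5, h3, hcase z h1⟩
    · have h6 : RankLE v (simpleSwap i * z) := by
        have := h2.raise_raise h4
        rwa [simpleSwap_mul_cancel] at this
      refine ⟨_, h6, h5, Or.inl ?_⟩
      ext x
      rw [mem_pre_simpleSwap_mul, h1, mem_pre_simpleSwap_mul, ← Perm.mul_apply,
        simpleSwap_mul_self, Perm.one_apply]

/-! ### Greedy bases -/

section greedy

variable {E F : Type*} [AddCommGroup E] [Module ℝ E] [AddCommGroup F] [Module ℝ F]

open Classical in
/-- The indices of the vectors that are not spanned by their predecessors. -/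
noncomputable def greedy (r : Fin n → E) : Finset (Fin n) :=
  {j | r j ∉ Submodule.span ℝ (r '' {i | i < j})}

lemma mem_greedy {r : Fin n → E} {j : Fin n} :
    j ∈ greedy r ↔ r j ∉ Submodule.span ℝ (r '' {i | i < j}) := by
  simp [greedy]

/-- Linear maps preserve dependence on predecessors. For truncation to fewer columns this makes
greedy bases nested. -/
lemma greedy_comp_subset (r : Fin n → E) (L : E →ₗ[ℝ] F) : greedy (L ∘ r) ⊆ greedy r := by
  intro j hj
  rw [mem_greedy] at *
  intro h
  apply hj
  rw [Set.image_comp, Submodule.span_image]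
  exact Submodule.mem_map_of_mem h

lemma greedy_filter_aux (r : Fin n → E) {m : ℕ} (hm : m ≤ n) :
    Submodule.span ℝ (r '' {j | j ∈ greedy r ∧ j.val < m}) =
        Submodule.span ℝ (r '' {j | j.val < m}) ∧
      LinearIndepOn ℝ r {j | j ∈ greedy r ∧ j.val < m} := by
  induction m with
  | zero => simp
  | succ m ih =>
    obtain ⟨h1, h2⟩ := ih (by omega)
    have e1 : {j : Fin n | j.val < m + 1} = insert ⟨m, hm⟩ {j : Fin n | j.val < m} := by
      ext j; simp [Fin.ext_iff]; omega
    have e3 : {j : Fin n | j < ⟨m, hm⟩} = {j : Fin n | j.val < m} := by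
      ext j; simp only [Set.mem_ofPred_eq, Fin.lt_def]
    have hmem : (⟨m, hm⟩ : Fin n) ∈ greedy r ↔
        r ⟨m, hm⟩ ∉ Submodule.span ℝ (r '' {j : Fin n | j.val < m}) := by
      rw [mem_greedy, e3]
    by_cases h : (⟨m, hm⟩ : Fin n) ∈ greedy r
    · have e2 : {j : Fin n | j ∈ greedy r ∧ j.val < m + 1} =
          insert ⟨m, hm⟩ {j : Fin n | j ∈ greedy r ∧ j.val < m} := by
        ext j
        simp only [Set.mem_ofPred_eq, Set.mem_insert_iff]
        constructor
        · rintro ⟨h3, h4⟩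
          by_cases h5 : j.val = m
          · exact Or.inl (Fin.ext h5)
          · exact Or.inr ⟨h3, by omega⟩
        · rintro (rfl | ⟨h3, h4⟩)
          · exact ⟨h, by simp⟩
          · exact ⟨h3, by omega⟩
      rw [e1, e2, Set.image_insert_eq, Set.image_insert_eq, Submodule.span_insert,
        Submodule.span_insert, h1]
      have h3 : r ⟨m, hm⟩ ∉
          Submodule.span ℝ (r '' {j : Fin n | j ∈ greedy r ∧ j.val < m}) := by
        rw [h1]; exact hmem.1 h
      exact ⟨rfl, h2.insert h3⟩
    · have e2 : {j : Fin n | j ∈ greedy r ∧ j.val < m + 1} =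
          {j : Fin n | j ∈ greedy r ∧ j.val < m} := by
        ext j
        simp only [Set.mem_ofPred_eq]
        constructor
        · rintro ⟨h3, h4⟩
          refine ⟨h3, lt_of_le_of_ne (by omega) fun h5 => h ?_⟩
          rwa [← show j = ⟨m, hm⟩ from Fin.ext h5]
        · rintro ⟨h3, h4⟩
          exact ⟨h3, by omega⟩
      rw [e1, e2, Set.image_insert_eq, h1]
      refine ⟨?_, h2⟩
      rw [hmem, not_not] at h
      exact (Submodule.span_insert_eq_span h).symm

lemma linearIndepOn_greedy (r : Fin n → E) : LinearIndepOn ℝ r (greedy r : Set (Fin n)) := by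
  have := (greedy_filter_aux r le_rfl).2
  refine this.mono fun j hj => ⟨hj, j.2⟩

/-- Both counts are dimensions: the greedy elements below `m` already span everything below `m`. -/
lemma card_filter_le_greedy (r : Fin n → E) {s : Finset (Fin n)}
    (hs : LinearIndepOn ℝ r (s : Set (Fin n))) {m : ℕ} (hm : m ≤ n) :
    #{j ∈ s | j.val < m} ≤ #{j ∈ greedy r | j.val < m} := by
  obtain ⟨h1, h2⟩ := greedy_filter_aux r hm
  have h3 : LinearIndepOn ℝ r (({j ∈ s | j.val < m} : Finset (Fin n)) : Set (Fin n)) :=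
    hs.mono fun j hj => by simp at hj; exact hj.1
  have e : (({j ∈ greedy r | j.val < m} : Finset (Fin n)) : Set (Fin n)) =
      {j | j ∈ greedy r ∧ j.val < m} := by ext; simp
  rw [← e] at h1 h2
  have c1 := finrank_span_eq_card (R := ℝ) h3
  have c2 := finrank_span_eq_card (R := ℝ) h2
  have r1 : ∀ t : Finset (Fin n), Set.range (fun j : (t : Set (Fin n)) => r j) = r '' t := by
    intro t; ext; simp
  rw [r1] at c1 c2
  simp only [Finset.coe_sort_coe, Fintype.card_coe] at c1 c2
  rw [← c1, ← c2, h1]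
  have : FiniteDimensional ℝ (Submodule.span ℝ (r '' {j : Fin n | j.val < m})) :=
    FiniteDimensional.span_of_finite ℝ (Set.toFinite _)
  refine Submodule.finrank_mono (Submodule.span_mono (Set.image_mono ?_))
  intro j hj
  simp at hj
  exact hj.2

end greedy

/-! ### Comparison of weights by partial sums, and chains of finite sets. -/

lemma sum_ite_lt_succ {M : Type*} [AddCommMonoid M] (g : Fin n → M) {m : ℕ} (hm : m < n) :
    ∑ j : Fin n, (if j.val < m + 1 then g j else 0) =
      ∑ j : Fin n, (if j.val < m then g j else 0) + g ⟨m, hm⟩ := by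
  have : g ⟨m, hm⟩ = ∑ j : Fin n, if j = ⟨m, hm⟩ then g j else 0 := by simp
  rw [this, ← Finset.sum_add_distrib]
  refine Finset.sum_congr rfl fun j _ => ?_
  by_cases h : j = ⟨m, hm⟩
  · subst h; simp
  · have : j.val ≠ m := fun h' => h (Fin.ext h')
    rw [if_neg h, add_zero]
    congr 1
    exact propext (by omega)

/-- Abel summation, as an induction that bounds each truncated sum by an upper bound of `d` times
the partial sum of `e`. -/
lemma sum_mul_nonpos_of_partial_sums {e d : Fin n → ℝ} (hd : Monotone d)
    (he : ∀ m ≤ n, 0 ≤ ∑ j : Fin n, if j.val < m then e j else 0) (h0 : ∑ j, e j = 0) :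
    ∑ j, e j * d j ≤ 0 := by
  have key : ∀ m ≤ n, ∀ M : ℝ, (∀ j : Fin n, j.val < m → d j ≤ M) →
      ∑ j : Fin n, (if j.val < m then e j * d j else 0) ≤
        M * ∑ j : Fin n, if j.val < m then e j else 0 := by
    intro m
    induction m with
    | zero => intro _ M _; simp
    | succ m ih =>
      intro hm M hM
      rw [sum_ite_lt_succ _ hm]
      have h1 := ih (by omega) (d ⟨m, hm⟩) fun j hj => hd (Fin.le_def.2 (by simp; omega))
      have h2 := he (m + 1) hm
      have h3 := mul_le_mul_of_nonneg_right (hM ⟨m, hm⟩ (by simp)) h2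
      rw [sum_ite_lt_succ _ hm] at h3 ⊢
      linarith
  rcases Nat.eq_zero_or_pos n with rfl | hn
  · simp
  · have := key n le_rfl (d ⟨n - 1, by omega⟩) fun j _ => hd (Fin.le_def.2 (by simp; omega))
    simpa [h0] using this

lemma sum_le_sum_of_card_filter {d : Fin n → ℝ} (hd : Monotone d) {A B : Finset (Fin n)}
    (hAB : #A = #B) (h : ∀ m ≤ n, #{j ∈ B | j.val < m} ≤ #{j ∈ A | j.val < m}) :
    ∑ j ∈ A, d j ≤ ∑ j ∈ B, d j := by
  have key := sum_mul_nonpos_of_partial_sums hd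
    (e := fun j => (if j ∈ A then 1 else 0) - (if j ∈ B then 1 else 0)) (fun m hm => ?_) ?_
  · simpa [sub_mul, Finset.sum_sub_distrib] using key
  · have e : ∀ C : Finset (Fin n), ((#{j ∈ C | j.val < m} : ℕ) : ℝ) =
        ∑ j : Fin n, if j.val < m then (if j ∈ C then 1 else 0) else 0 := by
      intro C
      rw [Finset.card_filter]
      push_cast
      rw [← Finset.sum_filter_add_sum_filter_not univ (fun j => j ∈ C)]
      rw [Finset.sum_filter, Finset.sum_filter, ← Finset.sum_add_distrib, ← Finset.sum_subset (Finset.subset_univ C)]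
      · refine Finset.sum_congr rfl fun j hj => ?_
        simp [hj]
      · intro j _ hj
        simp [hj]
    have h1 : ((#{j ∈ B | j.val < m} : ℕ) : ℝ) ≤ #{j ∈ A | j.val < m} := by exact_mod_cast h m hm
    rw [e, e] at h1
    have : ∑ j : Fin n, (if j.val < m then
        ((if j ∈ A then (1 : ℝ) else 0) - (if j ∈ B then 1 else 0)) else 0) =
        ∑ j : Fin n, (if j.val < m then (if j ∈ A then (1 : ℝ) else 0) else 0) -
        ∑ j : Fin n, (if j.val < m then (if j ∈ B then (1 : ℝ) else 0) else 0) := by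
      rw [← Finset.sum_sub_distrib]
      refine Finset.sum_congr rfl fun j _ => ?_
      split_ifs <;> simp
    rw [this]; linarith
  · simp [Finset.sum_sub_distrib, hAB]

/-- A maximal chain of finite sets is the chain of initial segments of a permutation. -/
lemma exists_perm_of_chain {A : ℕ → Finset (Fin n)} (hmono : Monotone A)
    (hcard : ∀ k ≤ n, #(A k) = k) :
    ∃ g : Perm (Fin n), ∀ k ≤ n, ∀ x, x ∈ A k ↔ (g⁻¹ x).val < k := by
  have hex : ∀ k : Fin n, ∃ x, x ∈ A (k.val + 1) ∧ x ∉ A k.val := by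
    intro k
    by_contra! h
    have := Finset.card_le_card (fun x hx => h x hx : A (k.val + 1) ⊆ A k.val)
    rw [hcard _ (by omega), hcard _ (by omega)] at this
    omega
  choose g hg hg' using hex
  have hinj : Function.Injective g := by
    have : ∀ k l : Fin n, k < l → g k ≠ g l := by
      intro k l hkl h
      exact hg' l (h ▸ hmono (Nat.succ_le_of_lt hkl) (hg k))
    intro k l h
    rcases lt_trichotomy k l with h1 | h1 | h1
    · exact absurd h (this k l h1)
    · exact h1
    · exact absurd h.symm (this l k h1)
  refine ⟨Equiv.ofBijective g (Finite.injective_iff_bijective.1 hinj), fun k hk x => ?_⟩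
  set G := Equiv.ofBijective g (Finite.injective_iff_bijective.1 hinj) with hG
  have hsub : (({j | j.val < k} : Finset (Fin n)).image g) ⊆ A k := by
    intro y hy
    simp only [mem_image, mem_filter, mem_univ, true_and] at hy
    obtain ⟨j, hj, rfl⟩ := hy
    exact hmono (Nat.succ_le_of_lt hj) (hg j)
  have heq := Finset.eq_of_subset_of_card_le hsub (by
    rw [hcard k hk, Finset.card_image_of_injective _ hinj, Fin.card_filter_val_lt]
    omega)
  rw [← heq]
  simp only [mem_image, mem_filter, mem_univ, true_and]
  constructor
  · rintro ⟨j, hj, rfl⟩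
    have : G⁻¹ (g j) = j := by
      rw [show g j = G j from rfl]; simp
    rwa [this]
  · intro h
    refine ⟨G⁻¹ x, h, ?_⟩
    rw [show g (G⁻¹ x) = G (G⁻¹ x) from rfl]; simp

/-- Lifting: an element may be raised below a descending upper bound. -/
lemma RankLE.raise_lower {i : Fin (n - 1)} {v w : Perm (Fin n)} (h : RankLE v w)
    (hw : ¬ Ascends i w) : RankLE (simpleSwap i * v) w := by
  by_cases hv : Ascends i v
  · have := (h.le_lower hv hw).raise_raise ((not_ascends_iff i w).1 hw)
    rwa [simpleSwap_mul_cancel] at this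
  · exact (rankLE_of_not_ascends hv).trans h

/-! ### Flags representing a Bruhat interval -/

/-- The minor of the matrix `x` with rows `f` in its first `k` columns. -/
noncomputable def minor (x : Fin n → ℕ → ℝ) {k : ℕ} (f : Fin k → Fin n) : ℝ :=
  (Matrix.of fun a b : Fin k => x (f a) b).det

/-- The nonvanishing minors of `x` in initial columns are those of the interval `[v, w]`. -/
def Represents (x : Fin n → ℕ → ℝ) (v w : Perm (Fin n)) : Prop :=
  ∀ k ≤ n, ∀ f : Fin k → Fin n,
    minor x f ≠ 0 ↔ ∃ u, RankLE v u ∧ RankLE u w ∧ Set.range f = pre u k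

lemma minor_eq_zero_of_eq (x : Fin n → ℕ → ℝ) {k : ℕ} {f : Fin k → Fin n} {a b : Fin k}
    (hab : a ≠ b) (h : f a = f b) : minor x f = 0 :=
  Matrix.det_zero_of_row_eq hab (by funext c; simp [h])

lemma injective_of_minor_ne_zero {x : Fin n → ℕ → ℝ} {k : ℕ} {f : Fin k → Fin n}
    (h : minor x f ≠ 0) : Function.Injective f := by
  intro a b hab
  by_contra hne
  exact h (minor_eq_zero_of_eq x hne hab)

lemma injective_of_range_eq_pre {k : ℕ} (hk : k ≤ n) {f : Fin k → Fin n} {u : Perm (Fin n)}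
    (h : Set.range f = pre u k) : Function.Injective f := by
  have hlt : ∀ a, (u⁻¹ (f a)).val < k := fun a => mem_pre.1 (h ▸ Set.mem_range_self a)
  have hsurj : Function.Surjective fun a : Fin k => (⟨(u⁻¹ (f a)).val, hlt a⟩ : Fin k) := by
    intro b
    have : u (Fin.castLE hk b) ∈ pre u k := by rw [mem_pre]; simp
    rw [← h] at this
    obtain ⟨a, ha⟩ := this
    refine ⟨a, Fin.ext ?_⟩
    simp [ha]
  have hinj := Finite.injective_iff_surjective.2 hsurj
  intro a b hab
  exact hinj (by simp [hab])

lemma minor_one_ne_zero_iff {k : ℕ} (hk : k ≤ n) (f : Fin k → Fin n) :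
    minor (fun j b => if j.val = b then 1 else 0) f ≠ 0 ↔ Set.range f = pre 1 k := by
  have hp : ∀ x : Fin n, x ∈ pre (1 : Perm (Fin n)) k ↔ x.val < k := fun x => by simp [mem_pre]
  constructor
  · intro h
    have hinj := injective_of_minor_ne_zero h
    have hlt : ∀ a, (f a).val < k := by
      intro a
      by_contra hge
      refine h (Matrix.det_eq_zero_of_row_eq_zero a fun b => ?_)
      simp only [Matrix.of_apply, ite_eq_right_iff, one_ne_zero, imp_false]
      omega
    have hsurj : Function.Surjective fun a : Fin k => (⟨(f a).val, hlt a⟩ : Fin k) :=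
      Finite.injective_iff_surjective.1 fun a b hab => hinj (Fin.ext (by simpa using hab))
    ext x
    rw [hp]
    constructor
    · rintro ⟨a, rfl⟩; exact hlt a
    · intro hx
      obtain ⟨a, ha⟩ := hsurj ⟨x.val, hx⟩
      exact ⟨a, Fin.ext (by simpa using ha)⟩
  · intro h
    have hlt : ∀ a, (f a).val < k := fun a => (hp _).1 (h ▸ Set.mem_range_self a)
    have hf := injective_of_range_eq_pre hk h
    have hbij : Function.Bijective fun a : Fin k => (⟨(f a).val, hlt a⟩ : Fin k) :=
      Finite.injective_iff_bijective.1 fun a b hab => hf (Fin.ext (by simpa using hab))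
    have hM : (Matrix.of fun a b : Fin k => if (f a).val = b.val then (1 : ℝ) else 0) =
        (1 : Matrix (Fin k) (Fin k) ℝ).submatrix (Equiv.ofBijective _ hbij) id := by
      ext a b
      simp [Matrix.one_apply, Fin.ext_iff]
    rw [minor, hM, Matrix.det_permute, Matrix.det_one, mul_one]
    simp

lemma represents_one : Represents (fun (j : Fin n) b => if j.val = b then 1 else 0) 1 1 := by
  intro k hk f
  rw [minor_one_ne_zero_iff hk]
  constructor
  · exact fun h => ⟨1, RankLE.refl _, RankLE.refl _, h⟩
  · rintro ⟨u, -, hu, h⟩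
    rwa [hu.eq_one] at h

lemma range_simpleSwap_comp {i : Fin (n - 1)} {k : ℕ} {f : Fin k → Fin n} {u : Perm (Fin n)}
    {l : ℕ} : Set.range (simpleSwap i ∘ f) = pre u l ↔ Set.range f = pre (simpleSwap i * u) l := by
  have h : ∀ x, simpleSwap i (simpleSwap i x) = x := fun x => by
    rw [← Perm.mul_apply, simpleSwap_mul_self, Perm.one_apply]
  constructor
  · intro hf
    ext x
    rw [mem_pre_simpleSwap_mul, ← hf]
    constructor
    · rintro ⟨a, rfl⟩; exact ⟨a, rfl⟩
    · rintro ⟨a, ha⟩; exact ⟨a, (simpleSwap i).injective ha⟩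
  · intro hf
    ext x
    have := mem_pre_simpleSwap_mul (i := i) (u := u) (k := l) (x := simpleSwap i x)
    rw [h] at this
    rw [← this, ← hf]
    constructor
    · rintro ⟨a, rfl⟩; exact ⟨a, by simp [h]⟩
    · rintro ⟨a, ha⟩; exact ⟨a, by simp [ha, h]⟩

/-- If `v` is not below the lowered upper end, the whole interval is a translate. -/
lemma Represents.translate {i : Fin (n - 1)} {x : Fin n → ℕ → ℝ} {v w : Perm (Fin n)}
    (hx : Represents x (simpleSwap i * v) (simpleSwap i * w)) (hvw : RankLE v w)
    (hw : ¬ Ascends i w) (hv : ¬ RankLE v (simpleSwap i * w)) :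
    Represents (fun j => x (simpleSwap i j)) v w := by
  have hdv : ¬ Ascends i v := fun h => hv (hvw.le_lower h hw)
  intro k hk f
  have : minor (fun j => x (simpleSwap i j)) f = minor x (simpleSwap i ∘ f) := rfl
  rw [this, hx k hk]
  constructor
  · rintro ⟨u, h1, h2, h3⟩
    -- A descending `u` would lie above `v` itself, putting `v` below the lowered `w`.
    have hu : Ascends i u := by
      by_contra hu
      have := h1.raise_lower hu
      rw [simpleSwap_mul_cancel] at this
      exact hv (this.trans h2)
    refine ⟨simpleSwap i * u, ?_, ?_, range_simpleSwap_comp.1 h3⟩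
    · have := h1.raise_raise hu
      rwa [simpleSwap_mul_cancel] at this
    · have := h2.raise_raise ((not_ascends_iff i w).1 hw)
      rwa [simpleSwap_mul_cancel] at this
  · rintro ⟨u, h1, h2, h3⟩
    refine ⟨simpleSwap i * u, h1.lower_lower hdv, h2.lower_lower fun hu => ?_, ?_⟩
    · exact hv (h1.trans (h2.le_lower hu hw))
    · rw [range_simpleSwap_comp, simpleSwap_mul_cancel, h3]

/-- Each index excludes at most one value of `t` unless both coefficients vanish. -/
lemma exists_generic {ι : Type*} [Finite ι] (α β : ι → ℝ) :
    ∃ t : ℝ, ∀ c, α c + t * β c ≠ 0 ↔ α c ≠ 0 ∨ β c ≠ 0 := by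
  have hfin : (Set.range (fun c => -α c / β c) ∪ {0}).Finite :=
    (Set.finite_range _).union (Set.finite_singleton 0)
  obtain ⟨t, ht⟩ := hfin.infinite_compl.nonempty
  refine ⟨t, fun c => ?_⟩
  simp only [Set.mem_compl_iff, Set.mem_union, Set.mem_range, Set.mem_singleton_iff, not_or,
    not_exists] at ht
  constructor
  · intro h
    by_contra! h'
    exact h (by simp [h'])
  · intro h h0
    by_cases hβ : β c = 0
    · simp [hβ] at h h0; exact h h0
    · exact ht.1 c (by field_simp; linarith)

/-- The matrix obtained by adding `t` times row `i` to row `i + 1`. -/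
noncomputable def bridge (i : Fin (n - 1)) (t : ℝ) (x : Fin n → ℕ → ℝ) : Fin n → ℕ → ℝ :=
  fun j b => if j = hi i then x j b + t * x (lo i) b else x j b

lemma minor_bridge_of_forall_ne {i : Fin (n - 1)} (t : ℝ) (x : Fin n → ℕ → ℝ) {k : ℕ}
    {f : Fin k → Fin n} (hf : ∀ a, f a ≠ hi i) : minor (bridge i t x) f = minor x f := by
  unfold minor bridge
  simp [hf]

lemma minor_bridge {i : Fin (n - 1)} (t : ℝ) (x : Fin n → ℕ → ℝ) {k : ℕ}
    {f : Fin k → Fin n} (hinj : Function.Injective f) {a : Fin k} (ha : f a = hi i) :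
    minor (bridge i t x) f = minor x f + t * minor x (Function.update f a (lo i)) := by
  have h1 : (Matrix.of fun a b : Fin k => bridge i t x (f a) b) =
      Matrix.updateRow (Matrix.of fun a b : Fin k => x (f a) b) a
        ((fun b : Fin k => x (f a) b) + t • fun b : Fin k => x (lo i) b) := by
    ext c b
    by_cases hc : c = a
    · subst hc; simp [bridge, ha]
    · have : f c ≠ hi i := fun h => hc (hinj (h.trans ha.symm))
      simp [bridge, this, Matrix.updateRow_ne hc]
  have h2 : (Matrix.of fun c b : Fin k => x (Function.update f a (lo i) c) b) =
      Matrix.updateRow (Matrix.of fun a b : Fin k => x (f a) b) a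
        (fun b : Fin k => x (lo i) b) := by
    ext c b
    by_cases hc : c = a
    · subst hc; simp
    · simp [hc]
  have h3 : Matrix.updateRow (Matrix.of fun a b : Fin k => x (f a) b) a
        (fun b : Fin k => x (f a) b) = Matrix.of fun a b : Fin k => x (f a) b := by
    ext c b
    by_cases hc : c = a
    · subst hc; simp
    · simp [Matrix.updateRow_ne hc]
  unfold minor
  rw [h1, h2, Matrix.det_updateRow_add, Matrix.det_updateRow_smul, h3]

/-- Replacing `i + 1` by `i` in an injective enumeration is the action of `simpleSwap i` if `i`
does not occur. -/
lemma update_eq_simpleSwap_comp {i : Fin (n - 1)} {k : ℕ} {f : Fin k → Fin n}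
    (hinj : Function.Injective f) {a : Fin k} (ha : f a = hi i) (hlo : ∀ c, f c ≠ lo i) :
    Function.update f a (lo i) = simpleSwap i ∘ f := by
  funext c
  by_cases hc : c = a
  · subst hc; simp [ha]
  · have : f c ≠ hi i := fun h => hc (hinj (h.trans ha.symm))
    simp [hc, simpleSwap_apply, hlo c, this]

/-- A minor through row `i + 1` becomes a sum of two old minors, which for generic `t` vanishes only
if both do. The second one accounts for raised elements; `exists_pre_eq_or` shows that the larger
interval has no further initial segments. -/
lemma Represents.exists_bridge {i : Fin (n - 1)} {x : Fin n → ℕ → ℝ} {v w : Perm (Fin n)}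
    (hx : Represents x v w) (hvw : RankLE v w) (hw : Ascends i w) :
    ∃ t, Represents (bridge i t x) v (simpleSwap i * w) := by
  obtain ⟨t, ht⟩ := exists_generic
    (ι := Σ k : Fin (n + 1), (Fin k → Fin n) × Fin k)
    (fun c => minor x c.2.1) (fun c => minor x (Function.update c.2.1 c.2.2 (lo i)))
  refine ⟨t, fun k hk f => ?_⟩
  by_cases hinj : Function.Injective f
  swap
  · constructor
    · exact fun h => absurd (injective_of_minor_ne_zero h) hinj
    · rintro ⟨u, -, -, h⟩
      exact absurd (injective_of_range_eq_pre hk h) hinj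
  by_cases hf : ∃ a, f a = hi i
  · obtain ⟨a, ha⟩ := hf
    rw [minor_bridge t x hinj ha]
    have := ht ⟨⟨k, by omega⟩, f, a⟩
    simp only at this
    rw [this]
    constructor
    · rintro (h | h)
      · obtain ⟨u, h1, h2, h3⟩ := (hx k hk f).1 h
        exact ⟨u, h1, h2.trans hw.rankLE, h3⟩
      · obtain ⟨u, h1, h2, h3⟩ := (hx k hk _).1 h
        have hinj' := injective_of_minor_ne_zero h
        -- If row `i` were already used, the second minor would have a repeated row.
        have hlo : ∀ c, f c ≠ lo i := by
          intro c hc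
          have hca : c ≠ a := by rintro rfl; exact lo_ne_hi i (hc.symm.trans ha)
          exact hca (hinj' (by simp [hca, hc]))
        rw [update_eq_simpleSwap_comp hinj ha hlo, range_simpleSwap_comp] at h3
        refine ⟨_, ?_, h2.raise_raise hw, h3⟩
        have hnlo : lo i ∉ pre (simpleSwap i * u) k := by
          rw [← h3]; rintro ⟨c, hc⟩; exact hlo c hc
        have hhi : hi i ∈ pre (simpleSwap i * u) k := by rw [← h3]; exact ⟨a, ha⟩
        rw [mem_pre_simpleSwap_mul, simpleSwap_lo, mem_pre] at hnlo
        rw [mem_pre_simpleSwap_mul, simpleSwap_hi, mem_pre] at hhi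
        have hu : Ascends i u := by unfold Ascends; rw [Fin.lt_def]; omega
        exact h1.trans hu.rankLE
    · rintro ⟨u, h1, h2, h3⟩
      obtain ⟨y, hy1, hy2, hy | ⟨-, hlo, hy⟩⟩ := exists_pre_eq_or k hw hvw h1 h2
      · exact Or.inl ((hx k hk f).2 ⟨y, hy1, hy2, h3.trans hy.symm⟩)
      · refine Or.inr ((hx k hk _).2 ⟨y, hy1, hy2, ?_⟩)
        rw [update_eq_simpleSwap_comp hinj ha fun c hc => hlo (h3 ▸ ⟨c, hc⟩), hy,
          range_simpleSwap_comp, simpleSwap_mul_cancel, h3]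
  · push Not at hf
    rw [minor_bridge_of_forall_ne t x hf, hx k hk]
    constructor
    · rintro ⟨u, h1, h2, h3⟩
      exact ⟨u, h1, h2.trans hw.rankLE, h3⟩
    · rintro ⟨u, h1, h2, h3⟩
      obtain ⟨y, hy1, hy2, hy | ⟨hhi, -, -⟩⟩ := exists_pre_eq_or k hw hvw h1 h2
      · exact ⟨y, hy1, hy2, h3.trans hy.symm⟩
      · rw [← h3] at hhi
        obtain ⟨a, ha⟩ := hhi
        exact absurd ha (hf a)

lemma exists_represents {v w : Perm (Fin n)} (h : RankLE v w) :
    ∃ x : Fin n → ℕ → ℝ, Represents x v w := by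
  induction hm : inv w generalizing v w with
  | zero =>
    have hw : w = 1 := by
      by_contra hw
      obtain ⟨i, hi⟩ := exists_not_ascends hw
      have := inv_simpleSwap_mul_of_not hi
      omega
    subst hw
    obtain rfl := h.eq_one
    exact ⟨_, represents_one⟩
  | succ m ih =>
    have hw : w ≠ 1 := by rintro rfl; rw [inv_one] at hm; omega
    obtain ⟨i, hi⟩ := exists_not_ascends hw
    have hlen := inv_simpleSwap_mul_of_not hi
    by_cases hv : RankLE v (simpleSwap i * w)
    · obtain ⟨x, hx⟩ := ih hv (by omega)
      obtain ⟨t, ht⟩ := hx.exists_bridge hv ((not_ascends_iff i w).1 hi)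
      rw [simpleSwap_mul_cancel] at ht
      exact ⟨_, ht⟩
    · have hdv : ¬ Ascends i v := fun h' => hv (h.le_lower h' hi)
      obtain ⟨x, hx⟩ := ih (h.lower_lower hdv) (by omega)
      exact ⟨_, hx.translate h hi hv⟩

/-! ### Simultaneous minimization of prefix sums over an interval. -/

lemma perm_inv_apply_self (u : Perm (Fin n)) (x : Fin n) : u⁻¹ (u x) = x := by simp

lemma perm_apply_inv_self (u : Perm (Fin n)) (x : Fin n) : u (u⁻¹ x) = x := by simp

lemma rk_eq_card_pre (u : Perm (Fin n)) (a b : ℕ) :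
    rk u a b = #{x : Fin n | (u⁻¹ x).val < a ∧ b ≤ x.val} := by
  rw [rk_eq_sum, Finset.card_filter,
    ← Equiv.sum_comp u fun x : Fin n => if (u⁻¹ x).val < a ∧ b ≤ x.val then 1 else 0]
  simp only [perm_inv_apply_self]

lemma rk_eq_of_pre_eq {u u' : Perm (Fin n)} {a : ℕ} (h : pre u a = pre u' a) (b : ℕ) :
    rk u a b = rk u' a b := by
  rw [rk_eq_card_pre, rk_eq_card_pre]
  congr 1
  ext x
  have : x ∈ pre u a ↔ x ∈ pre u' a := by rw [h]
  rw [mem_pre, mem_pre] at this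
  simp only [mem_filter, mem_univ, true_and, this]

lemma rankLE_of_forall_le {v w : Perm (Fin n)} (h : ∀ a ≤ n, ∀ b, rk v a b ≤ rk w a b) :
    RankLE v w := by
  intro a b
  by_cases ha : a ≤ n
  · exact h a ha b
  · have key : ∀ u : Perm (Fin n), rk u a b = rk u n b := by
      intro u
      unfold rk
      congr 1
      ext j
      have := j.2
      simp
      omega
    rw [key, key]
    exact h n le_rfl b

/-- The sum of the weights of the first `k` values. -/
noncomputable def prefixSum (c : Fin n → ℝ) (u : Perm (Fin n)) (k : ℕ) : ℝ :=
  ∑ j : Fin n, if j.val < k then c (u j) else 0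

lemma prefixSum_eq (c : Fin n → ℝ) (u σ : Perm (Fin n)) (k : ℕ) :
    prefixSum c u k = ∑ j ∈ ({j | (u⁻¹ (σ j)).val < k} : Finset (Fin n)), c (σ j) := by
  unfold prefixSum
  rw [Finset.sum_filter, ← Equiv.sum_comp (σ⁻¹ * u) fun j => if (u⁻¹ (σ j)).val < k then c (σ j)
    else 0]
  simp only [Perm.mul_apply, perm_apply_inv_self, perm_inv_apply_self]

/-- The interval `[v, w]` is a flag matroid: for each weight there is an element whose initial
segments have minimal weight simultaneously. -/
lemma exists_forall_prefixSum_le {v w : Perm (Fin n)} (hvw : RankLE v w) (c : Fin n → ℝ) :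
    ∃ u₀, RankLE v u₀ ∧ RankLE u₀ w ∧
      ∀ u, RankLE v u → RankLE u w → ∀ k ≤ n, prefixSum c u₀ k ≤ prefixSum c u k := by
  obtain ⟨x, hx⟩ := exists_represents hvw
  -- Rows are taken in order of increasing weight, so that greedy bases are the lightest ones.
  obtain ⟨σ, hσ⟩ : ∃ σ : Perm (Fin n), Monotone (c ∘ σ) := ⟨Tuple.sort c, Tuple.monotone_sort c⟩
  let r : ∀ k : ℕ, Fin n → (Fin k → ℝ) := fun k j b => x (σ j) b
  let A : ℕ → Finset (Fin n) := fun k => greedy (r k)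
  have hA : Monotone A := by
    intro k k' hk
    exact greedy_comp_subset (r k') (LinearMap.funLeft ℝ ℝ (Fin.castLE hk))
  let B : Perm (Fin n) → ℕ → Finset (Fin n) := fun u k => {j | (u⁻¹ (σ j)).val < k}
  have hBcard : ∀ u, ∀ k ≤ n, #(B u k) = k := by
    intro u k hk
    have : B u k = ({j | j.val < k} : Finset (Fin n)).map (σ⁻¹ * u : Perm (Fin n)).toEmbedding := by
      ext j
      simp only [B, mem_filter, mem_univ, true_and, mem_map_equiv]
      rfl
    rw [this, Finset.card_map, Fin.card_filter_val_lt]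
    omega
  have hBind : ∀ u, RankLE v u → RankLE u w → ∀ k ≤ n,
      LinearIndepOn ℝ (r k) (B u k : Set (Fin n)) := by
    intro u h1 h2 k hk
    let f : Fin k → Fin n := fun a => u (Fin.castLE hk a)
    have hf : Set.range f = pre u k := by
      ext y
      rw [mem_pre]
      constructor
      · rintro ⟨a, rfl⟩; simp [f]
      · intro hy; exact ⟨⟨(u⁻¹ y).val, hy⟩, by simp [f]⟩
    have hdet := (hx k hk f).2 ⟨u, h1, h2, hf⟩
    have hli := Matrix.linearIndependent_rows_of_det_ne_zero hdet
    have hli' : LinearIndependent ℝ (r k ∘ (fun a => σ⁻¹ (f a))) := by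
      have e : r k ∘ (fun a => σ⁻¹ (f a)) = (Matrix.of fun a b : Fin k => x (f a) b).row := by
        funext a b
        simp only [r, Function.comp_apply, perm_apply_inv_self]
        rfl
      rw [e]
      exact hli
    have hr : (B u k : Set (Fin n)) = Set.range fun a => σ⁻¹ (f a) := by
      ext j
      simp only [B, coe_filter, mem_univ, true_and, Set.mem_ofPred_eq, Set.mem_range]
      rw [← mem_pre, ← hf]
      constructor
      · rintro ⟨a, ha⟩; exact ⟨a, by rw [ha]; simp⟩
      · rintro ⟨a, ha⟩; exact ⟨a, by rw [← ha]; simp⟩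
    rw [hr]
    have hinj : Function.Injective fun a => σ⁻¹ (f a) :=
      (σ⁻¹).injective.comp (injective_of_range_eq_pre hk hf)
    exact (linearIndepOn_range_iff hinj (r k)).2 hli'
  have hle : ∀ u, RankLE v u → RankLE u w → ∀ k ≤ n, ∀ m ≤ n,
      #{j ∈ B u k | j.val < m} ≤ #{j ∈ A k | j.val < m} :=
    fun u h1 h2 k hk m hm => card_filter_le_greedy (r k) (hBind u h1 h2 k hk) hm
  have hAcard : ∀ k ≤ n, #(A k) = k := by
    intro k hk
    refine le_antisymm ?_ ?_
    · have := (linearIndepOn_greedy (r k)).linearIndependent.fintype_card_le_finrank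
      simpa using this
    · have := hle v (RankLE.refl v) hvw k hk n le_rfl
      simpa [hBcard v k hk] using this
  have hAB : ∀ k ≤ n, ∃ u, RankLE v u ∧ RankLE u w ∧ B u k = A k := by
    intro k hk
    let f : Fin k → Fin n := fun a => σ ((A k).orderEmbOfFin (hAcard k hk) a)
    have hli : LinearIndependent ℝ (Matrix.of fun a b : Fin k => x (f a) b).row := by
      have h1 := (linearIndepOn_greedy (r k)).linearIndependent
      have h2 := h1.comp (fun a : Fin k => (⟨(A k).orderEmbOfFin (hAcard k hk) a,
        Finset.orderEmbOfFin_mem _ _ a⟩ : (greedy (r k) : Set (Fin n)))) (by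
          intro a b hab
          simpa using hab)
      exact h2
    have hdet : minor x f ≠ 0 :=
      ((Matrix.isUnit_iff_isUnit_det _).1 (Matrix.linearIndependent_rows_iff_isUnit.1 hli)).ne_zero
    obtain ⟨u, h1, h2, h3⟩ := (hx k hk f).1 hdet
    refine ⟨u, h1, h2, ?_⟩
    ext j
    simp only [B, mem_filter, mem_univ, true_and]
    rw [← mem_pre, ← h3]
    have h4 : j ∈ A k ↔ j ∈ Set.range ((A k).orderEmbOfFin (hAcard k hk)) := by
      rw [Finset.range_orderEmbOfFin]; rfl
    rw [h4]
    constructor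
    · rintro ⟨a, ha⟩; exact ⟨a, σ.injective ha⟩
    · rintro ⟨a, ha⟩; exact ⟨a, by simp [f, ha]⟩
  obtain ⟨g, hg⟩ := exists_perm_of_chain hA hAcard
  have hgB : ∀ k ≤ n, B (σ * g) k = A k := by
    intro k hk
    ext j
    simp only [B, mem_filter, mem_univ, true_and]
    rw [hg k hk, mul_inv_rev, Perm.mul_apply, perm_inv_apply_self]
  -- Different `k` may need different `u`. This suffices because column `k` of the rank function
  -- depends only on the set of the first `k` values.
  have hpre : ∀ k ≤ n, ∃ u, RankLE v u ∧ RankLE u w ∧ pre (σ * g) k = pre u k := by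
    intro k hk
    obtain ⟨u, h1, h2, h3⟩ := hAB k hk
    refine ⟨u, h1, h2, ?_⟩
    rw [← hgB k hk] at h3
    ext y
    have : σ⁻¹ y ∈ B u k ↔ σ⁻¹ y ∈ B (σ * g) k := by rw [h3]
    simp only [B, mem_filter, mem_univ, true_and, perm_apply_inv_self] at this
    rw [mem_pre, mem_pre]
    exact this.symm
  refine ⟨σ * g, ?_, ?_, ?_⟩
  · refine rankLE_of_forall_le fun a ha b => ?_
    obtain ⟨u, h1, h2, h3⟩ := hpre a ha
    rw [rk_eq_of_pre_eq h3]
    exact h1 a b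
  · refine rankLE_of_forall_le fun a ha b => ?_
    obtain ⟨u, h1, h2, h3⟩ := hpre a ha
    rw [rk_eq_of_pre_eq h3]
    exact h2 a b
  · intro u h1 h2 k hk
    rw [prefixSum_eq c _ σ, prefixSum_eq c u σ]
    change ∑ j ∈ B (σ * g) k, (c ∘ σ) j ≤ ∑ j ∈ B u k, (c ∘ σ) j
    rw [hgB k hk]
    exact sum_le_sum_of_card_filter hσ (by rw [hAcard k hk, hBcard u k hk])
      (fun m hm => hle u h1 h2 k hk m hm)

/-! ### Faces of a polytope with labelled points -/

section faces

variable {Y E : Type*} [AddCommGroup E] [Module ℝ E]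

/-- The labels at which a real function is maximal. -/
def argmax (g : Y → ℝ) : Set Y := {y | ∀ y', g y' ≤ g y}

lemma mem_argmax {g : Y → ℝ} {y : Y} : y ∈ argmax g ↔ ∀ y', g y' ≤ g y := Iff.rfl

lemma argmax_nonempty [Finite Y] [Nonempty Y] (g : Y → ℝ) : (argmax g).Nonempty :=
  Finite.exists_max g

lemma le_of_mem_convexHull_range {p : Y → E} {l : E →ₗ[ℝ] ℝ} {M : ℝ} (h : ∀ y, l (p y) ≤ M) {x : E}
    (hx : x ∈ convexHull ℝ (Set.range p)) : l x ≤ M := by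
  have : convexHull ℝ (Set.range p) ⊆ {x | l x ≤ M} :=
    convexHull_min (by rintro _ ⟨y, rfl⟩; exact h y) (convex_halfSpace_le l.isLinear M)
  exact this hx

/-- A convex combination attaining the bound gives positive weight only to points attaining it. -/
lemma mem_convexHull_argmax {p : Y → E} {l : E →ₗ[ℝ] ℝ} {M : ℝ} (h : ∀ y, l (p y) ≤ M)
    {x : E} (hx : x ∈ convexHull ℝ (Set.range p)) (hM : l x = M) :
    x ∈ convexHull ℝ (p '' {y | l (p y) = M}) := by
  obtain ⟨ι, _, c, z, hc0, hc1, hz, rfl⟩ := mem_convexHull_iff_exists_fintype.1 hx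
  have hle : ∀ a, l (z a) ≤ M := by
    intro a
    obtain ⟨y, hy⟩ := hz a
    rw [← hy]; exact h y
  have hsum : ∑ a, c a * (M - l (z a)) = 0 := by
    simp only [mul_sub, Finset.sum_sub_distrib, ← Finset.sum_mul, hc1]
    simp only [map_sum, map_smul, smul_eq_mul] at hM
    rw [hM]; ring
  rw [Finset.sum_eq_zero_iff_of_nonneg fun a _ =>
    mul_nonneg (hc0 a) (sub_nonneg.2 (hle a))] at hsum
  rw [← Fintype.sum_subset (s := {a | c a ≠ 0})
    fun a ha => mem_filter.2 ⟨mem_univ _, left_ne_zero_of_smul ha⟩]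
  refine (convex_convexHull ..).sum_mem (fun a _ => hc0 _) (by rwa [sum_filter_ne_zero])
    fun a ha => subset_convexHull _ _ ?_
  obtain ⟨y, hy⟩ := hz a
  refine ⟨y, ?_, hy⟩
  have := (mul_eq_zero.1 (hsum a (mem_univ a))).resolve_left (mem_filter.1 ha).2
  rw [Set.mem_ofPred_eq, hy]
  linarith

variable [TopologicalSpace E]

/-- The label sets of the faces of the polytope spanned by `p`. -/
def IsFaceSet (p : Y → E) (S : Set Y) : Prop :=
  S = ∅ ∨ ∃ l : StrongDual ℝ E, S = argmax fun y => l (p y)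

lemma setOf_maximizers_eq [Finite Y] [Nonempty Y] (p : Y → E) (l : StrongDual ℝ E) :
    {x ∈ convexHull ℝ (Set.range p) | ∀ y ∈ convexHull ℝ (Set.range p), l y ≤ l x} =
      convexHull ℝ (p '' argmax fun y => l (p y)) := by
  obtain ⟨y₀, hy₀⟩ := argmax_nonempty fun y => l (p y)
  have hset : (argmax fun y => l (p y)) = {y | l (p y) = l (p y₀)} := by
    ext y
    exact ⟨fun hy => le_antisymm (hy₀ y) (hy y₀), fun hy y' => (hy₀ y').trans_eq hy.symm⟩
  have hmem : ∀ y, p y ∈ convexHull ℝ (Set.range p) := fun y => subset_convexHull _ _ ⟨y, rfl⟩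
  rw [hset]
  ext x
  constructor
  · rintro ⟨hx, hmax⟩
    refine mem_convexHull_argmax (l := l.toLinearMap) hy₀ hx (le_antisymm ?_ ?_)
    · exact le_of_mem_convexHull_range (l := l.toLinearMap) hy₀ hx
    · exact hmax _ (hmem y₀)
  · intro hx
    have hx' : x ∈ convexHull ℝ (Set.range p) :=
      convexHull_mono (Set.image_subset_range _ _) hx
    have hval : l x = l (p y₀) := by
      have : convexHull ℝ (p '' {y | l (p y) = l (p y₀)}) ⊆ {x | l x = l (p y₀)} :=
        convexHull_min (by rintro _ ⟨y, hy, rfl⟩; exact hy)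
          (convex_hyperplane l.toLinearMap.isLinear _)
      exact this hx
    refine ⟨hx', fun y hy => ?_⟩
    rw [hval]
    exact le_of_mem_convexHull_range (l := l.toLinearMap) hy₀ hy

/-- The faces of the polytope spanned by finitely many labelled points correspond to their label
sets. -/
noncomputable def faceOrderIso [Finite Y] [Nonempty Y] (p : Y → E) :
    Face (convexHull ℝ (Set.range p)) ≃o {S : Set Y // IsFaceSet p S} := by
  have hmem : ∀ y, p y ∈ convexHull ℝ (Set.range p) := fun y => subset_convexHull _ _ ⟨y, rfl⟩
  have key : ∀ F : Face (convexHull ℝ (Set.range p)), F.1 = ∅ ∨ ∃ l : StrongDual ℝ E,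
      F.1 = convexHull ℝ (p '' argmax fun y => l (p y)) ∧ p ⁻¹' F.1 = argmax fun y => l (p y) := by
    rintro ⟨F, hF⟩
    rcases F.eq_empty_or_nonempty with h | h
    · exact Or.inl h
    · obtain ⟨l, hl⟩ := hF h
      refine Or.inr ⟨l, hl.trans (setOf_maximizers_eq p l), ?_⟩
      ext y
      simp only [hl, Set.mem_preimage]
      constructor
      · rintro ⟨-, h⟩ y'
        exact h _ (hmem y')
      · intro h
        exact ⟨hmem y, fun x hx => le_of_mem_convexHull_range (l := l.toLinearMap) h hx⟩
  have hull : ∀ F : Face (convexHull ℝ (Set.range p)), convexHull ℝ (p '' (p ⁻¹' F.1)) = F.1 := by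
    intro F
    rcases key F with h | ⟨l, h1, h2⟩
    · simp [h]
    · rw [h2, ← h1]
  refine
    { toFun := fun F => ⟨p ⁻¹' F.1, ?_⟩
      invFun := fun S => ⟨convexHull ℝ (p '' S.1), ?_⟩
      left_inv := fun F => Subtype.ext (hull F)
      right_inv := fun S => Subtype.ext ?_
      map_rel_iff' := ?_ }
  · rcases key F with h | ⟨l, -, h⟩
    · left; rw [h, Set.preimage_empty]
    · exact Or.inr ⟨l, h⟩
  · rintro ⟨x, hx⟩
    rcases S.2 with h | ⟨l, h⟩
    · simp [h] at hx
    · exact ⟨l, by rw [h, ← setOf_maximizers_eq p l]⟩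
  · rcases S.2 with h | ⟨l, h⟩
    · simp [h]
    · simp only [h, ← setOf_maximizers_eq p l]
      ext y
      constructor
      · rintro ⟨-, h⟩ y'
        exact h _ (hmem y')
      · intro h
        exact ⟨hmem y, fun x hx => le_of_mem_convexHull_range (l := l.toLinearMap) h hx⟩
  · intro F F'
    constructor
    · intro h
      change F.1 ⊆ F'.1
      rw [← hull F, ← hull F']
      exact convexHull_mono (Set.image_mono h)
    · intro h
      exact Set.preimage_mono h

lemma combinatoriallyEquivalent_of_isFaceSet_iff {E' : Type*} [AddCommGroup E'] [Module ℝ E']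
    [TopologicalSpace E'] [Finite Y] [Nonempty Y] {p : Y → E} {p' : Y → E'}
    (h : ∀ S, IsFaceSet p S ↔ IsFaceSet p' S) :
    CombinatoriallyEquivalent (convexHull ℝ (Set.range p)) (convexHull ℝ (Set.range p')) := by
  have : (IsFaceSet p : Set Y → Prop) = IsFaceSet p' := funext fun S => propext (h S)
  refine ⟨(faceOrderIso p).trans ?_⟩
  rw [this]
  exact (faceOrderIso p').symm

end faces

/-! ### Prisms -/

section prism

variable {X E : Type*} [AddCommGroup E] [Module ℝ E]

/-- The points of two families, labelled by a base point and a Boolean. -/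
def joined {F : Type*} (a b : X → F) : X × Bool → F := fun y => if y.2 then b y.1 else a y.1

lemma convexHull_range_prism (a : X → E) :
    convexHull ℝ (Set.range (joined (fun x => (a x, (0 : ℝ))) fun x => (a x, (1 : ℝ)))) =
      convexHull ℝ (Set.range a) ×ˢ Set.Icc (0 : ℝ) 1 := by
  have : Set.range (joined (fun x => (a x, (0 : ℝ))) fun x => (a x, (1 : ℝ))) =
      Set.range a ×ˢ {0, 1} := by
    ext ⟨y, t⟩
    simp only [Set.mem_range, Prod.exists, Bool.exists_bool, joined, Set.mem_prod,
      Set.mem_insert_iff, Set.mem_singleton_iff]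
    constructor
    · rintro ⟨x, h | h⟩ <;> simp at h <;> exact ⟨⟨x, h.1⟩, by simp [h.2]⟩
    · rintro ⟨⟨x, rfl⟩, rfl | rfl⟩ <;> exact ⟨x, by simp⟩
  rw [this, convexHull_prod, convexHull_pair, segment_eq_Icc zero_le_one]

variable [TopologicalSpace E]

/-- A label set that is empty or the product of a face of `a` and a nonempty set of Booleans. -/
def IsPrismSet (a : X → E) (S : Set (X × Bool)) : Prop :=
  S = ∅ ∨ ∃ (l : StrongDual ℝ E) (β : Set Bool), β.Nonempty ∧ S = (argmax fun x => l (a x)) ×ˢ β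

lemma comp_joined (a b : X → E) (l : StrongDual ℝ E) :
    (fun y => l (joined a b y)) = joined (fun x => l (a x)) fun x => l (b x) := by
  funext ⟨x, c⟩
  cases c <;> rfl

lemma joined_le_iff {f g : X → ℝ} {M : ℝ} :
    (∀ y, joined f g y ≤ M) ↔ (∀ x, f x ≤ M) ∧ ∀ x, g x ≤ M := by
  simp [joined, Prod.forall, Bool.forall_bool, forall_and]

lemma argmax_joined_bot {f g : X → ℝ} {x₀ : X} (h : ∀ x, g x < f x₀) :
    argmax (joined f g) = argmax f ×ˢ {false} := by
  ext ⟨x, c⟩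
  rw [mem_argmax, joined_le_iff]
  cases c
  · simp only [joined, Bool.false_eq_true, if_false, Set.mem_prod, Set.mem_singleton_iff, and_true]
    exact ⟨fun h => h.1, fun h' => ⟨h', fun x => (h x).le.trans (h' x₀)⟩⟩
  · simp only [joined, if_true, Set.mem_prod, Set.mem_singleton_iff, Bool.true_eq_false, and_false,
      iff_false]
    rintro ⟨h1, -⟩
    exact absurd (h1 x₀) (not_le.2 (h x))

lemma argmax_joined_top {f g : X → ℝ} {x₀ : X} (h : ∀ x, f x < g x₀) :
    argmax (joined f g) = argmax g ×ˢ {true} := by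
  ext ⟨x, c⟩
  rw [mem_argmax, joined_le_iff]
  cases c
  · simp only [joined, Bool.false_eq_true, if_false, Set.mem_prod, Set.mem_singleton_iff, and_false,
      iff_false]
    rintro ⟨-, h1⟩
    exact absurd (h1 x₀) (not_le.2 (h x))
  · simp only [joined, if_true, Set.mem_prod, Set.mem_singleton_iff, and_true]
    exact ⟨fun h => h.2, fun h' => ⟨fun x => (h x).le.trans (h' x₀), h'⟩⟩

lemma argmax_joined_both {f g : X → ℝ} {x₀ : X} (h₀ : x₀ ∈ argmax f) (h : argmax f = argmax g)
    (hfg : f x₀ = g x₀) : argmax (joined f g) = argmax f ×ˢ Set.univ := by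
  have hg : x₀ ∈ argmax g := h ▸ h₀
  ext ⟨x, c⟩
  rw [mem_argmax, joined_le_iff]
  cases c
  · simp only [joined, Bool.false_eq_true, if_false, Set.mem_prod, Set.mem_univ, and_true]
    exact ⟨fun h => h.1, fun h' => ⟨h', fun x => (hg x).trans (hfg ▸ h' x₀)⟩⟩
  · simp only [joined, if_true, Set.mem_prod, Set.mem_univ, and_true]
    rw [h]
    exact ⟨fun h => h.2, fun h' => ⟨fun x => (h₀ x).trans (hfg ▸ h' x₀), h'⟩⟩

lemma bool_set_cases {β : Set Bool} (h : β.Nonempty) : β = {false} ∨ β = {true} ∨ β = Set.univ := by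
  by_cases h1 : true ∈ β <;> by_cases h2 : false ∈ β
  · right; right; ext c; cases c <;> simp [h1, h2]
  · right; left; ext c; cases c <;> simp [h1, h2]
  · left; ext c; cases c <;> simp [h1, h2]
  · obtain ⟨c, hc⟩ := h; cases c <;> contradiction

lemma argmax_add_const (f : X → ℝ) (t : ℝ) : argmax (fun x => f x + t) = argmax f := by
  ext x; simp [mem_argmax]

/-- Two families in parallel hyperplanes on which all functionals have the same maximizers span a
prism. -/
lemma isFaceSet_joined_iff_of_argmax_eq [Finite X] [Nonempty X] {a b : X → E} (h : StrongDual ℝ E)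
    {α : ℝ} (ha : ∀ x, h (a x) = α) (hb : ∀ x, h (b x) = α + 1)
    (hab : ∀ l : StrongDual ℝ E, (argmax fun x => l (a x)) = argmax fun x => l (b x))
    (S : Set (X × Bool)) : IsFaceSet (joined a b) S ↔ IsPrismSet a S := by
  refine or_congr Iff.rfl ⟨?_, ?_⟩
  · rintro ⟨l, rfl⟩
    obtain ⟨x₀, hx₀⟩ := argmax_nonempty fun x => l (a x)
    have hx₀' : x₀ ∈ argmax fun x => l (b x) := hab l ▸ hx₀
    rw [comp_joined]
    rcases lt_trichotomy (l (b x₀)) (l (a x₀)) with h1 | h1 | h1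
    · exact ⟨l, {false}, by simp, argmax_joined_bot fun x => (hx₀' x).trans_lt h1⟩
    · exact ⟨l, Set.univ, by simp, argmax_joined_both hx₀ (hab l) h1.symm⟩
    · refine ⟨l, {true}, by simp, ?_⟩
      rw [hab l]
      exact argmax_joined_top fun x => (hx₀ x).trans_lt h1
  · rintro ⟨l, β, hβ, rfl⟩
    obtain ⟨x₀, hx₀⟩ := argmax_nonempty fun x => l (a x)
    have hx₀' : x₀ ∈ argmax fun x => l (b x) := hab l ▸ hx₀
    have hl : ∀ t : ℝ, (argmax fun x => (l + t • h) (a x)) = argmax fun x => l (a x) := by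
      intro t
      simp only [add_apply, smul_apply, ha]
      exact argmax_add_const _ _
    have hl' : ∀ t : ℝ, (argmax fun x => (l + t • h) (b x)) = argmax fun x => l (a x) := by
      intro t
      rw [← hab, hl]
    have hva : ∀ (t : ℝ) x, (l + t • h) (a x) = l (a x) + t * α := by intro t x; simp [ha]
    have hvb : ∀ (t : ℝ) x, (l + t • h) (b x) = l (b x) + t * (α + 1) := by intro t x; simp [hb]
    -- Adding `t • h` keeps the maximizers on each copy and raises the second maximum by `t`
    -- relative to the first; `t` is the gap minus one, plus one, or exactly the gap.
    rcases bool_set_cases hβ with rfl | rfl | rfl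
    · refine ⟨l + (l (a x₀) - l (b x₀) - 1) • h, ?_⟩
      rw [comp_joined, argmax_joined_bot (x₀ := x₀), hl]
      intro x
      rw [hva, hvb]
      have := hx₀' x
      simp only at this
      linarith
    · refine ⟨l + (l (a x₀) - l (b x₀) + 1) • h, ?_⟩
      rw [comp_joined, argmax_joined_top (x₀ := x₀), hl']
      intro x
      rw [hva, hvb]
      have := hx₀ x
      simp only at this
      linarith
    · refine ⟨l + (l (a x₀) - l (b x₀)) • h, ?_⟩
      rw [comp_joined, argmax_joined_both (x₀ := x₀) (by rw [hl]; exact hx₀) (by rw [hl, hl']), hl]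
      rw [hva, hvb]
      ring

/-- A family in a hyperplane and its image under a linear involution that moves all points in the
same direction span a prism. -/
lemma isFaceSet_joined_iff_of_involution [Finite X] [Nonempty X] {a b : X → E}
    (h : StrongDual ℝ E) {α : ℝ} (ha : ∀ x, h (a x) = α) (T : E →L[ℝ] E) (hTa : ∀ x, T (a x) = b x)
    (hTb : ∀ x, T (b x) = a x) {e : E} (he : h e = 1) {δ : X → ℝ} (hδ : ∀ x, 0 < δ x)
    (hb : ∀ x, b x = a x + δ x • e) (S : Set (X × Bool)) :
    IsFaceSet (joined a b) S ↔ IsPrismSet a S := by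
  have hlb : ∀ (l : StrongDual ℝ E) x, l (b x) = l (a x) + δ x * l e := by
    intro l x; rw [hb, map_add, map_smul, smul_eq_mul]
  have hla : ∀ (l : StrongDual ℝ E) (t : ℝ),
      (argmax fun x => (l + t • h) (a x)) = argmax fun x => l (a x) := by
    intro l t
    simp only [add_apply, smul_apply, ha]
    exact argmax_add_const _ _
  have hbot : ∀ l : StrongDual ℝ E, l e < 0 →
      (argmax fun y => l (joined a b y)) = (argmax fun x => l (a x)) ×ˢ {false} := by
    intro l hl
    obtain ⟨x₀, hx₀⟩ := argmax_nonempty fun x => l (a x)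
    rw [comp_joined, argmax_joined_bot (x₀ := x₀)]
    intro x
    have h1 := hx₀ x
    have h2 := mul_neg_of_pos_of_neg (hδ x) hl
    simp only at h1
    rw [hlb]; linarith
  have hboth : ∀ l : StrongDual ℝ E, l e = 0 →
      (argmax fun y => l (joined a b y)) = (argmax fun x => l (a x)) ×ˢ Set.univ := by
    intro l hl
    obtain ⟨x₀, hx₀⟩ := argmax_nonempty fun x => l (a x)
    have : (fun x => l (b x)) = fun x => l (a x) := by funext x; rw [hlb, hl]; simp
    rw [comp_joined, this, argmax_joined_both hx₀ rfl rfl]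
  have htop : ∀ l : StrongDual ℝ E, 0 < l e →
      (argmax fun y => l (joined a b y)) = (argmax fun x => l (b x)) ×ˢ {true} := by
    intro l hl
    obtain ⟨x₀, hx₀⟩ := argmax_nonempty fun x => l (b x)
    rw [comp_joined, argmax_joined_top (x₀ := x₀)]
    intro x
    have h1 := hx₀ x
    have h2 := mul_pos (hδ x) hl
    simp only at h1
    rw [hlb l x] at h1
    linarith
  refine or_congr Iff.rfl ⟨?_, ?_⟩
  · rintro ⟨l, rfl⟩
    rcases lt_trichotomy (l e) 0 with h1 | h1 | h1
    · exact ⟨l, {false}, by simp, hbot l h1⟩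
    · exact ⟨l, Set.univ, by simp, hboth l h1⟩
    · refine ⟨l.comp T, {true}, by simp, ?_⟩
      rw [htop l h1]
      simp [hTa]
  · rintro ⟨l, β, hβ, rfl⟩
    have hval : ∀ t : ℝ, (l + t • h) e = l e + t := by intro t; simp [he]
    rcases bool_set_cases hβ with rfl | rfl | rfl
    · refine ⟨l + (-l e - 1) • h, ?_⟩
      rw [hbot _ (by rw [hval]; linarith), hla]
    -- A functional favouring the first copy is composed with `T`, which interchanges the copies.
    -- Its sign on `e` is then read off from a point, as nothing is assumed about `T e`.
    · refine ⟨(l + (-l e - 1) • h).comp T, ?_⟩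
      rw [htop]
      · simp only [ContinuousLinearMap.comp_apply, hTb]
        rw [hla]
      · obtain ⟨x⟩ := ‹Nonempty X›
        have h1 := hlb ((l + (-l e - 1) • h).comp T) x
        have h2 := hlb (l + (-l e - 1) • h) x
        simp only [ContinuousLinearMap.comp_apply, hTa, hTb] at h1
        rw [h2, hval] at h1
        by_contra hneg
        have := mul_nonpos_of_nonneg_of_nonpos (hδ x).le (not_lt.1 hneg)
        simp only [ContinuousLinearMap.comp_apply] at this
        have := hδ x
        linarith
    · refine ⟨l + (-l e) • h, ?_⟩
      rw [hboth _ (by rw [hval]; ring), hla]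

lemma isFaceSet_prism_iff [Finite X] [Nonempty X] (a : X → E) (S : Set (X × Bool)) :
    IsFaceSet (joined (fun x => (a x, (0 : ℝ))) fun x => (a x, (1 : ℝ))) S ↔ IsPrismSet a S := by
  have hsplit : ∀ (l : StrongDual ℝ (E × ℝ)) (y : E) (t : ℝ), l (y, t) = l (y, 0) + t * l (0, 1) := by
    intro l y t
    rw [← smul_eq_mul, ← map_smul, ← map_add]
    simp
  rw [isFaceSet_joined_iff_of_argmax_eq (ContinuousLinearMap.snd ℝ E ℝ) (α := 0) (by simp)
    (by simp)]
  · refine or_congr Iff.rfl ⟨?_, ?_⟩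
    · rintro ⟨l, β, hβ, rfl⟩
      exact ⟨l.comp (ContinuousLinearMap.inl ℝ E ℝ), β, hβ, by simp⟩
    · rintro ⟨l, β, hβ, rfl⟩
      exact ⟨l.comp (ContinuousLinearMap.fst ℝ E ℝ), β, hβ, by simp⟩
  · intro l
    have : (fun x => l (a x, (1 : ℝ))) = fun x => l (a x, 0) + l (0, 1) := by
      funext x; rw [hsplit]; simp
    rw [this, argmax_add_const]

lemma combinatoriallyEquivalent_prism [Finite X] [Nonempty X] {a b : X → E}
    (h : ∀ S, IsFaceSet (joined a b) S ↔ IsPrismSet a S) :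
    CombinatoriallyEquivalent (convexHull ℝ (Set.range (joined a b)))
      (convexHull ℝ (Set.range a) ×ˢ Set.Icc (0 : ℝ) 1) := by
  rw [← convexHull_range_prism]
  exact combinatoriallyEquivalent_of_isFaceSet_iff fun S =>
    (h S).trans (isFaceSet_prism_iff a S).symm

end prism

/-! ### Permutations whose support misses a simple transposition -/

/-- `u` preserves the initial segment of length `m`. -/
def Preserves (m : ℕ) (u : Perm (Fin n)) : Prop := ∀ j, j.val < m → (u j).val < m

lemma Preserves.inv {m : ℕ} {u : Perm (Fin n)} (h : Preserves m u) : Preserves m u⁻¹ :=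
  fun _ hj => Equiv.Perm.perm_symm_on_of_perm_on_finite (p := fun j : Fin n => j.val < m) h hj

lemma Preserves.iff {m : ℕ} {u : Perm (Fin n)} (h : Preserves m u) (j : Fin n) :
    (u j).val < m ↔ j.val < m :=
  ⟨fun hj => by have := h.inv _ hj; rwa [perm_inv_apply_self] at this, h j⟩

lemma preserves_iff_rk {m : ℕ} {u : Perm (Fin n)} : Preserves m u ↔ rk u m m = 0 := by
  unfold rk Preserves
  rw [Finset.card_eq_zero, Finset.filter_eq_empty_iff]
  simp

lemma Preserves.of_rankLE {m : ℕ} {u w : Perm (Fin n)} (h : Preserves m w) (huw : RankLE u w) :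
    Preserves m u := by
  rw [preserves_iff_rk] at *
  have := huw m m
  omega

lemma Preserves.ascends {r : Fin (n - 1)} {u : Perm (Fin n)} (h : Preserves (r.val + 1) u) :
    Ascends r u := by
  have h1 := (h.inv.iff (lo r)).2 (by simp)
  have h2 := (h.inv.iff (hi r)).not.2 (by simp)
  unfold Ascends
  rw [Fin.lt_def]
  omega

lemma preserves_simpleSwap {r i : Fin (n - 1)} (h : i ≠ r) :
    Preserves (r.val + 1) (simpleSwap i : Perm (Fin n)) := by
  intro j hj
  have : i.val ≠ r.val := fun h' => h (Fin.ext h')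
  rw [simpleSwap_apply]
  split_ifs with h1 h2
  · rw [h1, lo_val] at hj
    rw [hi_val]; omega
  · rw [h2, hi_val] at hj
    rw [lo_val]; omega
  · exact hj

lemma preserves_wordProd {r : Fin (n - 1)} {ω : List (Fin (n - 1))} (h : r ∉ ω) :
    Preserves (r.val + 1) (wordProd ω) := by
  induction ω with
  | nil => intro j hj; simpa [wordProd] using hj
  | cons i ω ih =>
    rw [List.mem_cons, not_or] at h
    rw [wordProd_cons]
    intro j hj
    exact preserves_simpleSwap (Ne.symm h.1) _ (ih h.2 j hj)

lemma preserves_of_notMem_support {r : Fin (n - 1)} {w : Perm (Fin n)} (h : r ∉ support w) :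
    Preserves (r.val + 1) w := by
  obtain ⟨ω, h1, h2⟩ := exists_word w
  rw [← h1]
  exact preserves_wordProd fun hr => h ⟨ω, isReducedWord_iff.2 ⟨h1, h2⟩, hr⟩

lemma mem_bruhatInterval {u v w : Perm (Fin n)} :
    u ∈ bruhatInterval v w ↔ RankLE v u ∧ RankLE u w := by
  rw [← bruhatLE_iff_rankLE, ← bruhatLE_iff_rankLE]; rfl

/-- Everything below `w` ascends at `r`, so the lifting property sorts the elements of the larger
interval by ascent or descent. -/
lemma mem_bruhatInterval_simpleSwap_mul {r : Fin (n - 1)} {u v w : Perm (Fin n)}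
    (hw : Preserves (r.val + 1) w) (hvw : RankLE v w) :
    u ∈ bruhatInterval v (simpleSwap r * w) ↔
      u ∈ bruhatInterval v w ∨ simpleSwap r * u ∈ bruhatInterval v w := by
  simp only [mem_bruhatInterval]
  have hasc := hw.ascends
  have hsw : ¬ Ascends r (simpleSwap r * w) := by
    rw [not_ascends_iff, simpleSwap_mul_cancel]; exact hasc
  have hv := (hw.of_rankLE hvw).ascends
  constructor
  · rintro ⟨h1, h2⟩
    by_cases hu : Ascends r u
    · left
      have := h2.le_lower hu hsw
      rw [simpleSwap_mul_cancel] at this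
      exact ⟨h1, this⟩
    · right
      have := h2.lower_lower hu
      rw [simpleSwap_mul_cancel] at this
      exact ⟨h1.le_lower hv hu, this⟩
  · rintro (⟨h1, h2⟩ | ⟨h1, h2⟩)
    · exact ⟨h1, h2.trans hasc.rankLE⟩
    · have h3 := (hw.of_rankLE h2).ascends.rankLE
      have h4 := h2.raise_raise hasc
      rw [simpleSwap_mul_cancel] at h3 h4
      exact ⟨h1.trans h3, h4⟩

lemma inv_mem_bruhatInterval {u v w : Perm (Fin n)} :
    u⁻¹ ∈ bruhatInterval v⁻¹ w⁻¹ ↔ u ∈ bruhatInterval v w := by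
  simp only [mem_bruhatInterval]
  constructor
  · rintro ⟨h1, h2⟩
    have h3 := h1.inv
    have h4 := h2.inv
    rw [inv_inv, inv_inv] at h3 h4
    exact ⟨h3, h4⟩
  · rintro ⟨h1, h2⟩
    exact ⟨h1.inv, h2.inv⟩

lemma mem_bruhatInterval_mul_simpleSwap {r : Fin (n - 1)} {u v w : Perm (Fin n)}
    (hw : Preserves (r.val + 1) w) (hvw : RankLE v w) :
    u ∈ bruhatInterval v (w * simpleSwap r) ↔
      u ∈ bruhatInterval v w ∨ u * simpleSwap r ∈ bruhatInterval v w := by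
  have h := mem_bruhatInterval_simpleSwap_mul (u := u⁻¹) hw.inv hvw.inv
  have e1 : simpleSwap r * w⁻¹ = (w * simpleSwap r)⁻¹ := by rw [mul_inv_rev, simpleSwap_inv]
  have e2 : simpleSwap r * u⁻¹ = (u * simpleSwap r)⁻¹ := by rw [mul_inv_rev, simpleSwap_inv]
  rwa [e1, e2, inv_mem_bruhatInterval, inv_mem_bruhatInterval, inv_mem_bruhatInterval] at h

/-! ### Linear functionals on permutation points -/

lemma dual_apply (l : StrongDual ℝ (Fin n → ℝ)) (x : Fin n → ℝ) :
    l x = ∑ i, l (Pi.single i 1) * x i := by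
  have : x = ∑ i, x i • (Pi.single i (1 : ℝ) : Fin n → ℝ) := by
    funext j
    simp [Finset.sum_apply, Pi.single_apply]
  conv_lhs => rw [this]
  rw [map_sum]
  refine Finset.sum_congr rfl fun i _ => ?_
  rw [map_smul, smul_eq_mul, mul_comm]

/-- Summation by layers: a value `j`, counted from zero, contributes `j + 1 = n - #{k < n | j < k}`.
-/
lemma sum_mul_permPoint (c : Fin n → ℝ) (u : Perm (Fin n)) :
    ∑ i, c i * permPoint u i = n * ∑ i, c i - ∑ k ∈ range n, prefixSum c u⁻¹ k := by
  have h1 : ∑ i, c i * permPoint u i = ∑ j, c (u⁻¹ j) * ((j.val : ℝ) + 1) := by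
    rw [← Equiv.sum_comp u⁻¹]
    simp only [permPoint, perm_apply_inv_self]
  have h2 : ∑ i, c i = ∑ j, c (u⁻¹ j) := (Equiv.sum_comp u⁻¹ c).symm
  rw [h1, h2]
  unfold prefixSum
  rw [Finset.sum_comm, Finset.mul_sum, ← Finset.sum_sub_distrib]
  refine Finset.sum_congr rfl fun j _ => ?_
  rw [← Finset.sum_filter, Finset.sum_const, nsmul_eq_mul]
  have : #{k ∈ range n | j.val < k} = n - 1 - j.val := by
    have : ({k ∈ range n | j.val < k}) = Finset.Ioo j.val n := by ext; simp; omega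
    rw [this, Nat.card_Ioo]; omega
  rw [this]
  have hj := j.2
  rw [Nat.cast_sub (by omega), Nat.cast_sub (by omega)]
  push_cast
  ring

lemma prefixSum_succ (c : Fin n → ℝ) (u : Perm (Fin n)) (j : Fin n) :
    prefixSum c u (j.val + 1) = prefixSum c u j.val + c (u j) :=
  sum_ite_lt_succ (fun j => c (u j)) j.2

lemma prefixSum_of_preserves (c : Fin n → ℝ) {u : Perm (Fin n)} {m : ℕ} (h : Preserves m u) :
    prefixSum c u m = prefixSum c 1 m := by
  unfold prefixSum
  rw [← Equiv.sum_comp u fun j => if j.val < m then c ((1 : Perm (Fin n)) j) else 0]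
  refine Finset.sum_congr rfl fun j _ => ?_
  simp only [h.iff j, Perm.one_apply]

lemma permPoint_simpleSwap_mul (r : Fin (n - 1)) (u : Perm (Fin n)) :
    permPoint (simpleSwap r * u) =
      permPoint u + (Pi.single (u⁻¹ (lo r)) 1 - Pi.single (u⁻¹ (hi r)) 1) := by
  funext j
  simp only [permPoint, Perm.mul_apply, simpleSwap_apply, Pi.add_apply, Pi.sub_apply,
    Pi.single_apply]
  have h1 : u j = lo r ↔ j = u⁻¹ (lo r) := by rw [Perm.eq_inv_iff_eq]
  have h2 : u j = hi r ↔ j = u⁻¹ (hi r) := by rw [Perm.eq_inv_iff_eq]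
  by_cases h3 : u j = lo r
  · have h4 : ¬ u j = hi r := by rw [h3]; exact lo_ne_hi r
    rw [if_pos h3, if_pos (h1.1 h3), if_neg fun h => h4 (h2.2 h), h3]
    simp
  · by_cases h4 : u j = hi r
    · rw [if_neg h3, if_pos h4, if_neg fun h => h3 (h1.2 h), if_pos (h2.1 h4), h4]
      simp
    · rw [if_neg h3, if_neg h4, if_neg fun h => h3 (h1.2 h), if_neg fun h => h4 (h2.2 h)]
      simp

lemma permPoint_mul_simpleSwap (r : Fin (n - 1)) (u : Perm (Fin n)) :
    permPoint (u * simpleSwap r) = permPoint u +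
      (((u (hi r)).val : ℝ) - (u (lo r)).val) • (Pi.single (lo r) 1 - Pi.single (hi r) 1) := by
  funext j
  simp only [permPoint, Perm.mul_apply, simpleSwap_apply, Pi.add_apply, Pi.sub_apply,
    Pi.single_apply, Pi.smul_apply, smul_eq_mul]
  by_cases h3 : j = lo r
  · have h4 : ¬ j = hi r := by rw [h3]; exact lo_ne_hi r
    rw [if_pos h3, if_pos h3, if_neg h4, h3]
    ring
  · by_cases h4 : j = hi r
    · rw [if_neg h3, if_pos h4, if_neg h3, if_pos h4, h4]
      ring
    · rw [if_neg h3, if_neg h4, if_neg h3, if_neg h4]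
      ring

/-- The sum of the first `m` coordinates. -/
noncomputable def sumFirst (m : ℕ) : StrongDual ℝ (Fin n → ℝ) :=
  ∑ j : Fin n, if j.val < m then ContinuousLinearMap.proj j else 0

lemma sumFirst_apply (m : ℕ) (x : Fin n → ℝ) :
    sumFirst m x = ∑ j : Fin n, if j.val < m then x j else 0 := by
  unfold sumFirst
  rw [_root_.sum_apply]
  refine Finset.sum_congr rfl fun j _ => ?_
  split_ifs <;> simp

lemma sumFirst_single (m : ℕ) (i : Fin n) :
    sumFirst m (Pi.single i 1) = if i.val < m then 1 else 0 := by
  rw [sumFirst_apply, Finset.sum_eq_single i]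
  · simp
  · intro j _ hj
    simp [hj]
  · simp

lemma sumFirst_permPoint {m : ℕ} {u : Perm (Fin n)} (h : Preserves m u) :
    sumFirst m (permPoint u) = sumFirst m (permPoint (1 : Perm (Fin n))) := by
  rw [sumFirst_apply, sumFirst_apply,
    ← Equiv.sum_comp u fun j => if j.val < m then permPoint (1 : Perm (Fin n)) j else 0]
  refine Finset.sum_congr rfl fun j _ => ?_
  simp [permPoint, h.iff j]

lemma argmax_add_eq {X : Type*} {f d : X → ℝ} {x₀ : X} (hf : ∀ x, f x ≤ f x₀)
    (hd : ∀ x, d x ≤ d x₀) (hfd : ∀ x, f x = f x₀ → d x = d x₀) :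
    argmax f = argmax fun x => f x + d x := by
  ext x
  constructor
  · intro hx y
    have h1 : f x = f x₀ := le_antisymm (hf x) (hx x₀)
    simp only
    rw [h1, hfd x h1]
    exact add_le_add (hf y) (hd y)
  · intro hx y
    have h1 := hx x₀
    have h2 := hd x
    simp only at h1
    exact (hf y).trans (by linarith)

/-- On a Bruhat interval whose elements preserve an initial segment, raising the last value of the
segment does not change the maximizers of linear functionals. -/
lemma argmax_permPoint_simpleSwap_mul {r : Fin (n - 1)} {v w : Perm (Fin n)}
    (hw : Preserves (r.val + 1) w) (hvw : RankLE v w) (l : StrongDual ℝ (Fin n → ℝ)) :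
    (argmax fun u : bruhatInterval v w => l (permPoint u.1)) =
      argmax fun u : bruhatInterval v w => l (permPoint (simpleSwap r * u.1)) := by
  obtain ⟨c, hc⟩ : ∃ c : Fin n → ℝ, c = fun i => l (Pi.single i 1) := ⟨_, rfl⟩
  obtain ⟨U, h1, h2, hmin⟩ := exists_forall_prefixSum_le hvw.inv c
  have hmem : ∀ u : bruhatInterval v w, RankLE v⁻¹ u.1⁻¹ ∧ RankLE u.1⁻¹ w⁻¹ := fun u =>
    mem_bruhatInterval.1 (inv_mem_bruhatInterval.2 u.2)
  let u₀ : bruhatInterval v w := ⟨U⁻¹, by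
    rw [← inv_mem_bruhatInterval, inv_inv, mem_bruhatInterval]; exact ⟨h1, h2⟩⟩
  have hu₀ : u₀.1⁻¹ = U := inv_inv U
  have hval : ∀ u : Perm (Fin n), l (permPoint u) =
      n * ∑ i, c i - ∑ k ∈ range n, prefixSum c u⁻¹ k := by
    intro u
    rw [dual_apply, ← sum_mul_permPoint, hc]
  -- The change of `l` is the difference of two consecutive increments of the prefix sum; the middle
  -- prefix sum is constant because `u⁻¹` preserves the segment.
  let d : bruhatInterval v w → ℝ := fun u => 2 * prefixSum c 1 (r.val + 1) -
    prefixSum c u.1⁻¹ r.val - prefixSum c u.1⁻¹ (r.val + 2)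
  have hd : ∀ u : bruhatInterval v w,
      l (permPoint (simpleSwap r * u.1)) = l (permPoint u.1) + d u := by
    intro u
    have hp : Preserves (r.val + 1) u.1⁻¹ := hw.inv.of_rankLE (hmem u).2
    have e1 : prefixSum c u.1⁻¹ (r.val + 1) = prefixSum c u.1⁻¹ r.val + c (u.1⁻¹ (lo r)) :=
      prefixSum_succ c _ (lo r)
    have e2 : prefixSum c u.1⁻¹ (r.val + 2) = prefixSum c u.1⁻¹ (r.val + 1) + c (u.1⁻¹ (hi r)) :=
      prefixSum_succ c _ (hi r)
    rw [prefixSum_of_preserves c hp] at e1 e2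
    rw [permPoint_simpleSwap_mul, map_add, map_sub]
    have e3 : ∀ i, l (Pi.single i 1) = c i := fun i => by rw [hc]
    rw [e3, e3]
    simp only [d]
    linarith
  simp only [hd]
  have hr := r.2
  have hle : ∀ u : bruhatInterval v w, ∀ k ≤ n, prefixSum c U k ≤ prefixSum c u.1⁻¹ k :=
    fun u => hmin _ (hmem u).1 (hmem u).2
  refine argmax_add_eq (x₀ := u₀) (fun u => ?_) (fun u => ?_) fun u hu => ?_
  · rw [hval, hval, hu₀]
    have := Finset.sum_le_sum fun k (hk : k ∈ range n) => hle u k (mem_range.1 hk).le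
    linarith
  · have e1 := hle u r.val (by omega)
    have e2 := hle u (r.val + 2) (by omega)
    simp only [d, hu₀]
    linarith
  · rw [hval, hval, hu₀] at hu
    have hsum : ∑ k ∈ range n, prefixSum c U k = ∑ k ∈ range n, prefixSum c u.1⁻¹ k := by linarith
    rw [Finset.sum_eq_sum_iff_of_le fun k hk => hle u k (mem_range.1 hk).le] at hsum
    -- The sum over `range n` omits `k = n`, which is needed when `r + 2 = n`.
    have hlast : ∀ u : Perm (Fin n), prefixSum c u n = ∑ i, c i := by
      intro u
      unfold prefixSum
      simp only [Fin.is_lt, if_true]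
      exact Equiv.sum_comp u c
    have heq : ∀ k ≤ n, prefixSum c U k = prefixSum c u.1⁻¹ k := by
      intro k hk
      rcases hk.eq_or_lt with rfl | hk
      · rw [hlast, hlast]
      · exact hsum k (mem_range.2 hk)
    simp only [d, hu₀]
    rw [heq r.val (by omega), heq (r.val + 2) (by omega)]

lemma bruhatIntervalPolytope_eq (v w : Perm (Fin n)) :
    bruhatIntervalPolytope v w =
      convexHull ℝ (Set.range fun u : bruhatInterval v w => permPoint u.1) := by
  unfold bruhatIntervalPolytope
  rw [Set.image_eq_range]

lemma bruhatIntervalPolytope_eq_joined {v w w' : Perm (Fin n)} (φ : Perm (Fin n) → Perm (Fin n))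
    (hφ : ∀ u, φ (φ u) = u)
    (h : ∀ u, u ∈ bruhatInterval v w' ↔ u ∈ bruhatInterval v w ∨ φ u ∈ bruhatInterval v w) :
    bruhatIntervalPolytope v w' =
      convexHull ℝ (Set.range (joined (fun u : bruhatInterval v w => permPoint u.1)
        fun u : bruhatInterval v w => permPoint (φ u.1))) := by
  unfold bruhatIntervalPolytope
  congr 1
  ext x
  simp only [Set.mem_image, Set.mem_range, Prod.exists, Bool.exists_bool, joined, h]
  constructor
  · rintro ⟨u, hu | hu, rfl⟩
    · exact ⟨⟨u, hu⟩, Or.inl rfl⟩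
    · exact ⟨⟨φ u, hu⟩, Or.inr (by simp [hφ])⟩
  · rintro ⟨u, h | h⟩
    · exact ⟨u.1, Or.inl u.2, h⟩
    · exact ⟨φ u.1, Or.inr (by rw [hφ]; exact u.2), h⟩

end BruhatPolytope

open BruhatPolytope in
theorem mainTheorem6 (n : ℕ) (v w : Equiv.Perm (Fin n)) (hvw : BruhatPolytope.BruhatLE v w)
    (r : Fin (n - 1)) (hr : r ∉ BruhatPolytope.support w) :
    BruhatPolytope.CombinatoriallyEquivalent
        (BruhatPolytope.bruhatIntervalPolytope v (BruhatPolytope.simpleSwap r * w))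
        (BruhatPolytope.bruhatIntervalPolytope v w ×ˢ Set.Icc (0 : ℝ) 1) ∧
      BruhatPolytope.CombinatoriallyEquivalent
        (BruhatPolytope.bruhatIntervalPolytope v (w * BruhatPolytope.simpleSwap r))
        (BruhatPolytope.bruhatIntervalPolytope v w ×ˢ Set.Icc (0 : ℝ) 1) := by
  have hle := hvw.rankLE
  have hw := preserves_of_notMem_support hr
  have hne : Nonempty (bruhatInterval v w) := ⟨⟨v, mem_bruhatInterval.2 ⟨RankLE.refl v, hle⟩⟩⟩
  have hpres : ∀ u : bruhatInterval v w, Preserves (r.val + 1) u.1 := fun u =>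
    hw.of_rankLE (mem_bruhatInterval.1 u.2).2
  rw [bruhatIntervalPolytope_eq v w]
  constructor
  · rw [bruhatIntervalPolytope_eq_joined (fun u => simpleSwap r * u) (simpleSwap_mul_cancel r)
      fun u => mem_bruhatInterval_simpleSwap_mul hw hle]
    -- The sum of the first `r + 1` coordinates grows by exactly one: the position of `lo r` lies in
    -- the segment and that of `hi r` outside.
    refine combinatoriallyEquivalent_prism (isFaceSet_joined_iff_of_argmax_eq
      (sumFirst (r.val + 1)) (fun u => sumFirst_permPoint (hpres u)) (fun u => ?_)
      (argmax_permPoint_simpleSwap_mul hw hle))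
    have h1 := ((hpres u).inv.iff (lo r)).2 (by simp)
    have h2 := ((hpres u).inv.iff (hi r)).not.2 (by simp)
    rw [permPoint_simpleSwap_mul, map_add, map_sub, sumFirst_permPoint (hpres u), sumFirst_single,
      sumFirst_single, if_pos h1, if_neg h2, sub_zero]
  · rw [bruhatIntervalPolytope_eq_joined (fun u => u * simpleSwap r)
      (fun u => by rw [mul_assoc, simpleSwap_mul_self, mul_one])
      fun u => mem_bruhatInterval_mul_simpleSwap hw hle]
    -- The involution exchanges two coordinates. The displacement `δ` is positive because `u` keeps
    -- `lo r` inside the segment and `hi r` outside.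
    refine combinatoriallyEquivalent_prism (isFaceSet_joined_iff_of_involution
      (sumFirst (r.val + 1)) (fun u => sumFirst_permPoint (hpres u))
      (ContinuousLinearMap.pi fun j => ContinuousLinearMap.proj (simpleSwap r j))
      (fun u => rfl) (fun u => ?_) (e := Pi.single (lo r) 1 - Pi.single (hi r) 1) ?_
      (δ := fun u => ((u.1 (hi r)).val : ℝ) - (u.1 (lo r)).val) (fun u => ?_)
      fun u => permPoint_mul_simpleSwap r u.1)
    · funext j
      change permPoint (u.1 * simpleSwap r * simpleSwap r) j = _
      rw [mul_assoc, simpleSwap_mul_self, mul_one]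
    · rw [map_sub, sumFirst_single, sumFirst_single]
      simp
    · have h1 := ((hpres u).iff (lo r)).2 (by simp)
      have h2 := ((hpres u).iff (hi r)).not.2 (by simp)
      rw [sub_pos, Nat.cast_lt]
      omega
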